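/- For an open set $\Omega\subset\mathbb{R}^2$ let $\mathcal{D}'(\Omega)$ denote the space of real distributions on $\Omega$. Let $L=(L_1,L_2)$ be the first-order linear differential operator from real functions on $\mathbb{R}^2$ to $\mathbb{R}^2$-valued functions given in Cartesian coordinates $(x,y)$ and polar coordinates $(r,\theta)$ by $$L_1=x\frac{\partial}{\partial x}+y\frac{\partial}{\partial y}-2=r\frac{\partial}{\partial r}-2,\qquad L_2=-y\frac{\partial}{\partial x}+x\frac{\partial}{\partial y}=\frac{\partial}{\partial\theta},$$ and extended to distributions by duality, $(L_iu)[\varphi]=u[L_i^*\varphi]$, where $L_i^*$ is the formally dual operator. A differential operator over an open set $M\subset\mathbb{R}^2$ is called hypoelliptic if for every open $\Omega\subset M$ every $u\in\mathcal{D}'(\Omega)$ with $Lu$ smooth is smooth; it is called weakly hypoelliptic if for every open $\Omega\subset M$ every $u\in\mathcal{D}'(\Omega)$ with $Lu=0$ is smooth. It is called overdetermined elliptic if its principal symbol is injective at every point of $M$ for every nonzero covector. Then: 1. $L$ is weakly hypoelliptic over $\mathbb{R}^2$, but not hypoelliptic over $\mathbb{R}^2$. 2. The distribution on $\mathbb{R}^2$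 given by the locally integrable function $u=r^2\log r$ is not smooth, while $Lu=(r^2,0)$ in the sense of distributions, which is smooth. 3. Over $\mathbb{R}^2\setminus\{0\}$ the operator $L$ is overdetermined elliptic and hypoelliptic. 4. If $R>0$ and $u$ is a distribution on the punctured disk $\{0<r<R\}$ with $Lu=0$, then there is a constant $\alpha\in\mathbb{R}$ such that $u=\alpha r^2$ on this punctured disk. 5. If $\Omega\subset\mathbb{R}^2$ is open and $u\in\mathcal{D}'(\Omega)$ satisfies $\operatorname{supp}(u)\subset\{0\}$ and $L_1u=0$, then $u=0$. -/

import Mathlib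

open TopologicalSpace MeasureTheory
open scoped Distributions ContDiff

noncomputable section

/-- Multiplication of test functions on `Ω` by a fixed smooth function `a : E → ℝ`, as a
continuous linear map `φ ↦ a φ` of the space of test functions. -/
def mulTestFunction {E : Type*} [NormedAddCommGroup E] [NormedSpace ℝ E] {Ω : Opens E}
    (a : E → ℝ) (ha : ContDiff ℝ ∞ a) : 𝓓(Ω, ℝ) →L[ℝ] 𝓓(Ω, ℝ) :=
  TestFunction.limitCLM ℝ
    (fun φ ↦ ⟨fun x ↦ a x * φ x, ha.mul φ.contDiff, φ.hasCompactSupport.mul_left,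
      (tsupport_mul_subset_right (f := a) (g := φ)).trans φ.tsupport_subset⟩)
    (fun _ K_sub_Ω ↦ TestFunction.ofSupportedInCLM ℝ K_sub_Ω ∘L
      ContDiffMapSupportedIn.bilinLeftCLM (ContinuousLinearMap.mul ℝ ℝ) ha)
    (fun _ _ φ ↦ by ext x; simp [mul_comm])

@[simp]
theorem mulTestFunction_apply {E : Type*} [NormedAddCommGroup E] [NormedSpace ℝ E] {Ω : Opens E}
    (a : E → ℝ) (ha : ContDiff ℝ ∞ a) (φ : 𝓓(Ω, ℝ)) (x : E) :
    mulTestFunction a ha φ x = a x * φ x := rfl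

namespace Distribution

variable {E : Type*} [NormedAddCommGroup E] [NormedSpace ℝ E] [MeasureSpace E] {Ω : Opens E}

/-- The distribution `u` on `Ω` is the regular distribution of the locally integrable function
`g`, that is, `u[φ] = ∫ φ g`. -/
def IsGivenBy (u : 𝓓'(Ω, ℝ)) (g : E → ℝ) : Prop :=
  LocallyIntegrableOn g Ω ∧ ∀ φ : 𝓓(Ω, ℝ), u φ = ∫ x, φ x * g x

/-- The distribution `u` on `Ω` is (given by) a smooth function on `Ω`. -/
def IsSmooth (u : 𝓓'(Ω, ℝ)) : Prop :=
  ∃ g : E → ℝ, ContDiffOn ℝ ∞ g Ω ∧ u.IsGivenBy g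

end Distribution

/-- A linear differential operator of order at most one with smooth coefficients on `ℝⁿ`, taking
real functions `f` to `ℝ^q`-valued functions: the `i`-th component of `L f` is
`(∑ j, a i j * ∂f/∂x_j) + b i * f`. -/
structure FirstOrderOperator (n q : ℕ) where
  a : Fin q → Fin n → EuclideanSpace ℝ (Fin n) → ℝ
  b : Fin q → EuclideanSpace ℝ (Fin n) → ℝ
  a_smooth : ∀ i j, ContDiff ℝ ∞ (a i j)
  b_smooth : ∀ i, ContDiff ℝ ∞ (b i)

namespace FirstOrderOperator

variable {n q : ℕ} (L : FirstOrderOperator n q)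

/-- The classical action of `L` on functions. -/
def onFunctions (f : EuclideanSpace ℝ (Fin n) → ℝ) (i : Fin q)
    (x : EuclideanSpace ℝ (Fin n)) : ℝ :=
  (∑ j, L.a i j x * fderiv ℝ f x (EuclideanSpace.single j 1)) + L.b i x * f x

/-- The formally dual operator, on test functions in the `i`-th component:
`φ ↦ -(∑ j, ∂(a i j * φ)/∂x_j) + b i * φ`. -/
def formalDual {Ω : Opens (EuclideanSpace ℝ (Fin n))} (i : Fin q) : 𝓓(Ω, ℝ) →L[ℝ] 𝓓(Ω, ℝ) :=
  -(∑ j, (TestFunction.lineDerivCLM ℝ (EuclideanSpace.single j 1)) ∘L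
      (mulTestFunction (L.a i j) (L.a_smooth i j))) +
    mulTestFunction (L.b i) (L.b_smooth i)

/-- The action of `L` on distributions, `(L u)[φ] = u[L* φ]`. A distribution with values in `ℝ^q`
is the tuple of its `q` scalar components. -/
def onDistributions {Ω : Opens (EuclideanSpace ℝ (Fin n))} (u : 𝓓'(Ω, ℝ)) :
    Fin q → 𝓓'(Ω, ℝ) :=
  fun i ↦ (L.formalDual i).precompCompactConvergenceCLM ℝ u

/-- `L`, as an operator over the open set `M ⊆ ℝⁿ`, is hypoelliptic: for every open `Ω ⊆ M`,
every distribution `u` on `Ω` such that `L u` is smooth is itself smooth. -/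
def IsHypoelliptic (M : Opens (EuclideanSpace ℝ (Fin n))) : Prop :=
  ∀ Ω : Opens (EuclideanSpace ℝ (Fin n)), Ω ≤ M → ∀ u : 𝓓'(Ω, ℝ),
    (∀ i, (L.onDistributions u i).IsSmooth) → u.IsSmooth

/-- `L`, as an operator over the open set `M ⊆ ℝⁿ`, is weakly hypoelliptic: for every open
`Ω ⊆ M`, every distribution `u` on `Ω` such that `L u = 0` is smooth. -/
def IsWeaklyHypoelliptic (M : Opens (EuclideanSpace ℝ (Fin n))) : Prop :=
  ∀ Ω : Opens (EuclideanSpace ℝ (Fin n)), Ω ≤ M → ∀ u : 𝓓'(Ω, ℝ),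
    L.onDistributions u = 0 → u.IsSmooth

/-- The principal symbol of `L` (as an operator of order one) at the point `x` and the covector
`ξ`, a linear map `ℝ → ℝ^q`. -/
def principalSymbol (x ξ : EuclideanSpace ℝ (Fin n)) : ℝ →ₗ[ℝ] (Fin q → ℝ) :=
  LinearMap.toSpanSingleton ℝ (Fin q → ℝ) (fun i ↦ ∑ j, L.a i j x * ξ j)

/-- `L` is overdetermined elliptic over `M`: its principal symbol is injective at every point of
`M` for all nonzero covectors. -/
def IsOverdeterminedElliptic (M : Opens (EuclideanSpace ℝ (Fin n))) : Prop :=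
  ∀ x ∈ M, ∀ ξ : EuclideanSpace ℝ (Fin n), ξ ≠ 0 → Function.Injective (L.principalSymbol x ξ)

end FirstOrderOperator

theorem FirstOrderOperator.formalDual_apply {n q : ℕ} (L : FirstOrderOperator n q)
    {Ω : Opens (EuclideanSpace ℝ (Fin n))} (i : Fin q) (φ : 𝓓(Ω, ℝ))
    (x : EuclideanSpace ℝ (Fin n)) :
    L.formalDual i φ x =
      -∑ j, fderiv ℝ (fun y ↦ L.a i j y * φ y) x (EuclideanSpace.single j 1) + L.b i x * φ x := by
  have h : ∀ j, (TestFunction.lineDerivCLM ℝ (EuclideanSpace.single j 1)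
      (mulTestFunction (L.a i j) (L.a_smooth i j) φ) : 𝓓(Ω, ℝ)) x =
      fderiv ℝ (fun y ↦ L.a i j y * φ y) x (EuclideanSpace.single j 1) := by
    intro j
    rw [TestFunction.lineDerivCLM_eq_fderivCLM, TestFunction.fderivCLM_apply_of_le _ (by simp)]
    rfl
  simp only [formalDual, add_apply, neg_apply, sum_apply, ContinuousLinearMap.comp_apply, h,
    mulTestFunction_apply]

/-- `formalDual` is indeed the formally dual operator: `∫ (L f)_i φ = ∫ f (L* φ)`. -/
theorem FirstOrderOperator.integral_onFunctions_mul {n q : ℕ} (L : FirstOrderOperator n q)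
    {Ω : Opens (EuclideanSpace ℝ (Fin n))} (i : Fin q) (f : EuclideanSpace ℝ (Fin n) → ℝ)
    (hf : ContDiff ℝ ∞ f) (φ : 𝓓(Ω, ℝ)) :
    ∫ x, L.onFunctions f i x * φ x = ∫ x, f x * L.formalDual i φ x := by
  have hψ : ∀ j, ContDiff ℝ ∞ (fun y ↦ L.a i j y * φ y) := fun j ↦
    (L.a_smooth i j).mul φ.contDiff
  have hc : ∀ j, HasCompactSupport (fun y ↦ L.a i j y * φ y) := fun j ↦
    φ.hasCompactSupport.mul_left
  have h0 : Continuous fun x ↦ L.b i x * f x := ((L.b_smooth i).mul hf).continuous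
  have h1 : ∀ j, Integrable (fun x ↦ fderiv ℝ f x (EuclideanSpace.single j 1) *
      (L.a i j x * φ x)) := fun j ↦
    (((hf.continuous_fderiv (by simp)).clm_apply continuous_const).mul
      (hψ j).continuous).integrable_of_hasCompactSupport (hc j).mul_left
  have h2 : ∀ j, Integrable (fun x ↦ f x *
      fderiv ℝ (fun y ↦ L.a i j y * φ y) x (EuclideanSpace.single j 1)) := fun j ↦
    (hf.continuous.mul (((hψ j).continuous_fderiv (by simp)).clm_apply
      continuous_const)).integrable_of_hasCompactSupport
      ((hc j).fderiv_apply ℝ (EuclideanSpace.single j 1)).mul_left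
  have h3 : Integrable (fun x ↦ L.b i x * f x * φ x) :=
    (h0.mul φ.continuous).integrable_of_hasCompactSupport φ.hasCompactSupport.mul_left
  have key : ∀ j, ∫ x, f x * fderiv ℝ (fun y ↦ L.a i j y * φ y) x (EuclideanSpace.single j 1) =
      -∫ x, fderiv ℝ f x (EuclideanSpace.single j 1) * (L.a i j x * φ x) := fun j ↦
    integral_mul_fderiv_eq_neg_fderiv_mul_of_integrable (h1 j) (h2 j)
      ((hf.continuous.mul (hψ j).continuous).integrable_of_hasCompactSupport (hc j).mul_left)
      (fun x _ ↦ (hf.differentiable (by simp)) x) (fun x _ ↦ ((hψ j).differentiable (by simp)) x)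
  have e1 : ∀ x, L.onFunctions f i x * φ x =
      (∑ j, fderiv ℝ f x (EuclideanSpace.single j 1) * (L.a i j x * φ x)) +
        L.b i x * f x * φ x := by
    intro x
    simp only [onFunctions, add_mul, Finset.sum_mul]
    congr 1
    exact Finset.sum_congr rfl fun j _ ↦ by ring
  have e2 : ∀ x, f x * L.formalDual i φ x =
      L.b i x * f x * φ x -
        ∑ j, f x * fderiv ℝ (fun y ↦ L.a i j y * φ y) x (EuclideanSpace.single j 1) := by
    intro x
    rw [formalDual_apply, mul_add, mul_neg, Finset.mul_sum]
    ring
  simp only [e1, e2]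
  rw [integral_add (integrable_finsetSum _ fun j _ ↦ h1 j) h3,
    integral_sub h3 (integrable_finsetSum _ fun j _ ↦ h2 j),
    integral_finsetSum _ fun j _ ↦ h1 j, integral_finsetSum _ fun j _ ↦ h2 j]
  simp only [key, Finset.sum_neg_distrib]
  ring

/-- The operator `L = (L₁, L₂)` on `ℝ²`, with components indexed by `0` and `1`:
`L₁ = x ∂/∂x + y ∂/∂y - 2 = r ∂/∂r - 2` and `L₂ = -y ∂/∂x + x ∂/∂y = ∂/∂θ`. -/
def polarOperator : FirstOrderOperator 2 2 where
  a := ![![fun p ↦ p 0, fun p ↦ p 1], ![fun p ↦ -p 1, fun p ↦ p 0]]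
  b := ![fun _ ↦ -2, fun _ ↦ 0]
  a_smooth i j := by fin_cases i <;> fin_cases j <;> simp <;> fun_prop
  b_smooth i := by fin_cases i <;> simp <;> fun_prop

/-- The punctured plane `ℝ² \ {0}`. -/
def puncturedPlane : Opens (EuclideanSpace ℝ (Fin 2)) := ⟨{0}ᶜ, isOpen_compl_singleton⟩

/-- The open disk of radius `R` centered at the origin, with the origin removed. -/
def puncturedDisk (R : ℝ) : Opens (EuclideanSpace ℝ (Fin 2)) :=
  ⟨Metric.ball 0 R \ {0}, Metric.isOpen_ball.sdiff isClosed_singleton⟩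

end

-- Off the origin put u = r² v. Then L₁u = r² · r∂v/∂r and L₂u = r² ∂v/∂θ, so Lu determines the
-- gradient of v: ∂v/∂x = (x L₁u − y L₂u)/r⁴ and ∂v/∂y = (y L₁u + x L₂u)/r⁴. Hypoellipticity there
-- reduces to the smoothness of a distribution on a square with smooth gradient
-- (`exists_smooth_of_lineDerivative_eq`), and Lu = 0 makes v locally constant
-- (`exists_const_of_lineDerivative_eq_zero`), hence constant on the connected punctured disk. Both
-- facts hold for arbitrary linear functionals; continuity of v plays no role.
--
-- Near the origin a solution of Lu = 0 equals α r² on a punctured disk, and u − α r² is supported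
-- at 0 and killed by L₁. Homogeneity forces it to vanish: derivatives of δ have degree at most −2,
-- while L₁ demands degree 2. Instead of the structure theorem for such distributions, the proof
-- solves the dual equation r∂w/∂r + 4w = φ with w smooth across 0 (`exists_radial_solution`). With
-- a cutoff η, the function φ + L₁*(ηw) vanishes near 0, so u[φ] = 0 (`eq_zero_of_dsupport_subset`).
--
-- Hypoellipticity fails at 0 because r² log r is C¹ but not smooth: its partial derivatives (2 log
-- r + 1)x_j are continuous but not differentiable at 0, yet L₁ turns it into r² and L₂ kills it.

universe u

/-! ### Smooth dependence of integrals on parameters. -/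

section ParametricIntegral

variable {E F : Type*} [NormedAddCommGroup E] [NormedSpace ℝ E] [FiniteDimensional ℝ E]

theorem hasFDerivAt_parametric_intervalIntegral [NormedAddCommGroup F] [NormedSpace ℝ F]
    {f : E × ℝ → F} (hf : ContDiff ℝ 1 f) (a b : ℝ) (x₀ : E) :
    HasFDerivAt (fun x ↦ ∫ t in a..b, f (x, t))
      (∫ t in a..b, (fderiv ℝ f (x₀, t)).comp (ContinuousLinearMap.inl ℝ E ℝ)) x₀ := by
  have hc : Continuous fun p : E × ℝ ↦ (fderiv ℝ f p).comp (ContinuousLinearMap.inl ℝ E ℝ) :=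
    (hf.continuous_fderiv (by simp)).clm_comp continuous_const
  have := FiniteDimensional.proper ℝ E
  obtain ⟨C, hC⟩ := ((isCompact_closedBall x₀ 1).prod
    (isCompact_uIcc (a := a) (b := b))).exists_bound_of_continuousOn hc.continuousOn
  refine intervalIntegral.hasFDerivAt_integral_of_dominated_of_fderiv_le
    (F := fun x t ↦ f (x, t))
    (F' := fun x t ↦ (fderiv ℝ f (x, t)).comp (ContinuousLinearMap.inl ℝ E ℝ))
    (bound := fun _ ↦ C) (Metric.closedBall_mem_nhds x₀ one_pos) ?_ ?_ ?_ ?_ ?_ ?_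
  · exact .of_forall fun x ↦ (hf.continuous.comp (by fun_prop)).aestronglyMeasurable
  · exact (hf.continuous.comp (by fun_prop)).intervalIntegrable _ _
  · exact (hc.comp (by fun_prop : Continuous fun t : ℝ ↦ (x₀, t))).aestronglyMeasurable
  · exact .of_forall fun t ht x hx ↦ hC (x, t) ⟨hx, Set.uIoc_subset_uIcc ht⟩
  · exact intervalIntegrable_const
  · refine .of_forall fun t _ x _ ↦ ?_
    have h : HasFDerivAt (fun y : E ↦ (y, t)) (ContinuousLinearMap.inl ℝ E ℝ) x :=
      hasFDerivAt_prodMk_left x t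
    exact ((hf.differentiable (by simp)) (x, t)).hasFDerivAt.comp x h

/-- The derivative is again a parametric integral, now with values in `E →L[ℝ] F`, so the induction
varies `F`. The common universe of `E` and `F` keeps that space in the range of the induction. -/
theorem ContDiff.parametric_intervalIntegral {E F : Type u} [NormedAddCommGroup E]
    [NormedSpace ℝ E] [FiniteDimensional ℝ E] [NormedAddCommGroup F] [NormedSpace ℝ F]
    {f : E × ℝ → F} (hf : ContDiff ℝ ∞ f) (a b : ℝ) :
    ContDiff ℝ ∞ fun x ↦ ∫ t in a..b, f (x, t) := by
  refine contDiff_infty.2 fun n ↦ ?_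
  induction n generalizing F with
  | zero =>
    refine contDiff_zero.2 (continuous_iff_continuousAt.2 fun x ↦ ?_)
    exact (hasFDerivAt_parametric_intervalIntegral (hf.of_le (by simp)) a b x).continuousAt
  | succ n ih =>
    refine contDiff_succ_iff_hasFDerivAt.2 ⟨_, ?_, fun x ↦
      hasFDerivAt_parametric_intervalIntegral (hf.of_le (by simp)) a b x⟩
    exact ih (f := fun p ↦ (fderiv ℝ f p).comp (ContinuousLinearMap.inl ℝ E ℝ))
      ((hf.fderiv_right (by simp)).clm_comp contDiff_const)

end ParametricIntegral

noncomputable section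

/-! ### Operations on test functions and localization of distributions. -/

section LocalProperties

variable {E : Type*} [NormedAddCommGroup E] [NormedSpace ℝ E] {Ω Ω₁ Ω₂ : Opens E}

namespace TestFunction

/-- The product of a test function on `Ω` and a function that is smooth on `Ω`. -/
def mulOn (a : E → ℝ) (ha : ContDiffOn ℝ ∞ a Ω) : 𝓓(Ω, ℝ) →ₗ[ℝ] 𝓓(Ω, ℝ) where
  toFun φ := ⟨fun x ↦ a x * φ x, by
    refine contDiff_iff_contDiffAt.2 fun x ↦ ?_
    by_cases hx : x ∈ tsupport φ
    · exact (ha.contDiffAt (Ω.isOpen.mem_nhds (φ.tsupport_subset hx))).mul φ.contDiff.contDiffAt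
    · refine (contDiffAt_const (c := (0 : ℝ))).congr_of_eventuallyEq ?_
      filter_upwards [(isClosed_tsupport φ).isOpen_compl.mem_nhds hx] with y hy
      simp [image_eq_zero_of_notMem_tsupport hy],
    φ.hasCompactSupport.mul_left,
    (tsupport_mul_subset_right (f := a) (g := φ)).trans φ.tsupport_subset⟩
  map_add' φ ψ := by ext x; simp [mul_add]
  map_smul' c φ := by ext x; simp [mul_left_comm]

@[simp]
theorem mulOn_apply (a : E → ℝ) (ha : ContDiffOn ℝ ∞ a Ω) (φ : 𝓓(Ω, ℝ)) (x : E) :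
    mulOn a ha φ x = a x * φ x := rfl

/-- Extension by zero of a test function to a larger open set. -/
def extend (_ : Ω₁ ≤ Ω₂) : 𝓓(Ω₁, ℝ) →L[ℝ] 𝓓(Ω₂, ℝ) := monoCLM ℝ

@[simp]
theorem extend_apply (h : Ω₁ ≤ Ω₂) (φ : 𝓓(Ω₁, ℝ)) (x : E) : extend h φ x = φ x := by
  simp [extend, h]

/-- A test function regarded as a test function on an open set containing its support. -/
def changeDomain (φ : 𝓓(Ω₁, ℝ)) (h : tsupport φ ⊆ Ω₂) : 𝓓(Ω₂, ℝ) :=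
  ⟨φ, φ.contDiff, φ.hasCompactSupport, h⟩

@[simp]
theorem changeDomain_apply (φ : 𝓓(Ω₁, ℝ)) (h : tsupport φ ⊆ Ω₂) (x : E) :
    φ.changeDomain h x = φ x := rfl

theorem apply_eq_zero_of_notMem (φ : 𝓓(Ω, ℝ)) {x : E} (hx : x ∉ Ω) : φ x = 0 :=
  image_eq_zero_of_notMem_tsupport fun h ↦ hx (φ.tsupport_subset h)

/-- The directional derivative of a test function. -/
abbrev lineDerivative (v : E) : 𝓓(Ω, ℝ) →L[ℝ] 𝓓(Ω, ℝ) := lineDerivCLM ℝ v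

theorem lineDerivative_apply (v : E) (φ : 𝓓(Ω, ℝ)) (x : E) :
    lineDerivative v φ x = fderiv ℝ φ x v := by
  rw [lineDerivCLM_eq_fderivCLM, fderivCLM_apply_of_le _ (by simp)]

end TestFunction

namespace Distribution

open TestFunction

/-- Restriction of a distribution to a smaller open set. -/
def restrict (h : Ω₁ ≤ Ω₂) (u : 𝓓'(Ω₂, ℝ)) : 𝓓'(Ω₁, ℝ) :=
  (extend h).precompCompactConvergenceCLM ℝ u

theorem restrict_apply (h : Ω₁ ≤ Ω₂) (u : 𝓓'(Ω₂, ℝ)) (φ : 𝓓(Ω₁, ℝ)) :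
    restrict h u φ = u (extend h φ) := rfl

section Regular

variable [MeasureSpace E]

theorem IsGivenBy.restrict {u : 𝓓'(Ω₂, ℝ)} {g : E → ℝ} (hu : u.IsGivenBy g) (h : Ω₁ ≤ Ω₂) :
    (restrict h u).IsGivenBy g :=
  ⟨hu.1.mono_set h, fun φ ↦ by simp [restrict_apply, hu.2]⟩

theorem IsSmooth.restrict {u : 𝓓'(Ω₂, ℝ)} (hu : u.IsSmooth) (h : Ω₁ ≤ Ω₂) :
    (restrict h u).IsSmooth := by
  obtain ⟨g, hg, hug⟩ := hu
  exact ⟨g, hg.mono h, hug.restrict h⟩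

variable [BorelSpace E]

theorem locallyIntegrableOn_of_continuousOn {X : Type*} [NormedAddCommGroup X] [MeasureSpace X]
    [BorelSpace X] [IsLocallyFiniteMeasure (volume : Measure X)] {U : Opens X} {g : X → ℝ}
    (hg : ContinuousOn g U) : LocallyIntegrableOn g U :=
  hg.locallyIntegrableOn U.isOpen.measurableSet

theorem integrable_mul (φ : 𝓓(Ω, ℝ)) {g : E → ℝ} (hg : LocallyIntegrableOn g Ω) :
    Integrable fun x ↦ φ x * g x :=
  φ.integrable_bilin (ContinuousLinearMap.mul ℝ ℝ) hg

/-- The regular distribution of a locally integrable function. -/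
def ofFunction (Ω : Opens E) (g : E → ℝ) : 𝓓'(Ω, ℝ) :=
  integralAgainstBilinCLM (ContinuousLinearMap.mul ℝ ℝ) volume g

theorem ofFunction_apply {g : E → ℝ} (hg : LocallyIntegrableOn g Ω) (φ : 𝓓(Ω, ℝ)) :
    ofFunction Ω g φ = ∫ x, φ x * g x :=
  integralAgainstBilinCLM_eq_integral hg

theorem isGivenBy_ofFunction {g : E → ℝ} (hg : LocallyIntegrableOn g Ω) :
    (ofFunction Ω g).IsGivenBy g := ⟨hg, ofFunction_apply hg⟩

end Regular

variable [FiniteDimensional ℝ E]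

/-- A cutoff χ that is 0 near supp φ \ V and 1 near supp φ \ W splits φ into χφ, supported in V, and
(1 − χ)φ, supported in W. -/
theorem IsVanishingOn.union {V W : Set E} (hV : IsOpen V) (hW : IsOpen W) {u : 𝓓'(Ω, ℝ)}
    (huV : IsVanishingOn u V) (huW : IsVanishingOn u W) : IsVanishingOn u (V ∪ W) := by
  intro φ hφ
  have hd : Disjoint (tsupport φ ∩ Vᶜ) (tsupport φ ∩ Wᶜ) := by
    rw [Set.disjoint_left]
    rintro x ⟨hx, hxV⟩ ⟨-, hxW⟩
    exact (hφ hx).elim hxV hxW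
  obtain ⟨χ, h0, h1, -⟩ := exists_contMDiffMap_zero_one_nhds_of_isClosed (n := ⊤)
    (modelWithCornersSelf ℝ E)
    ((isClosed_tsupport φ).inter hV.isClosed_compl) ((isClosed_tsupport φ).inter hW.isClosed_compl)
    hd
  have hχ : ContDiff ℝ ∞ χ := χ.contMDiff.contDiff
  have key : ∀ (a : E → ℝ) (ha : ContDiff ℝ ∞ a) (U : Set E),
      (∀ᶠ x in nhdsSet (tsupport φ ∩ Uᶜ), a x = 0) → tsupport (mulOn a ha.contDiffOn φ) ⊆ U := by
    intro a ha U h x hx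
    by_contra hxU
    have hxφ : x ∈ tsupport φ := tsupport_mul_subset_right (f := a) (g := φ) hx
    have hxs : x ∈ tsupport φ ∩ Uᶜ := ⟨hxφ, hxU⟩
    have h' : ∀ᶠ y in nhds x, a y = 0 := h.filter_mono (nhds_le_nhdsSet hxs)
    refine (notMem_tsupport_iff_eventuallyEq.2 ?_) hx
    filter_upwards [h'] with y hy
    simp [hy]
  have e : φ = mulOn χ hχ.contDiffOn φ + mulOn (fun x ↦ 1 - χ x)
      (contDiff_const.sub hχ).contDiffOn φ := by
    ext x; simp; ring
  rw [e, map_add, huV _ (key _ hχ _ h0), huW _ (key _ (contDiff_const.sub hχ) _ ?_), add_zero]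
  filter_upwards [h1] with x hx
  simp [hx]

theorem eq_zero_of_locally_isVanishingOn {u : 𝓓'(Ω, ℝ)}
    {φ : 𝓓(Ω, ℝ)} (h : ∀ x ∈ tsupport φ, ∃ V, IsOpen V ∧ x ∈ V ∧ IsVanishingOn u V) :
    u φ = 0 := by
  have : ∃ V, IsOpen V ∧ tsupport φ ⊆ V ∧ IsVanishingOn u V := by
    refine IsCompact.induction_on (p := fun s ↦ ∃ V, IsOpen V ∧ s ⊆ V ∧ IsVanishingOn u V)
      φ.hasCompactSupport ⟨∅, isOpen_empty, subset_rfl, ?_⟩ ?_ ?_ ?_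
    · intro ψ hψ
      have : ψ = 0 := by
        ext x
        exact image_eq_zero_of_notMem_tsupport fun hx ↦ hψ hx
      simp [this]
    · rintro s t hst ⟨V, hV, htV, hu⟩
      exact ⟨V, hV, hst.trans htV, hu⟩
    · rintro s t ⟨V, hV, hsV, huV⟩ ⟨W, hW, htW, huW⟩
      exact ⟨V ∪ W, hV.union hW, Set.union_subset_union hsV htW, huV.union hV hW huW⟩
    · intro x hx
      obtain ⟨V, hV, hxV, hu⟩ := h x hx
      exact ⟨V, mem_nhdsWithin_of_mem_nhds (hV.mem_nhds hxV), V, hV, subset_rfl, hu⟩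
  obtain ⟨V, -, hφ, hu⟩ := this
  exact hu φ hφ

end Distribution

end LocalProperties

/-! ### Distributions given by functions: integration by parts and gluing. -/

section Regular

variable {E : Type*} [NormedAddCommGroup E] [NormedSpace ℝ E] [FiniteDimensional ℝ E]
  [MeasureSpace E] [BorelSpace E] {Ω Ω₁ Ω₂ : Opens E}

namespace Distribution

open TestFunction

theorem eqOn_zero_of_forall_integral_mul_eq_zero [(volume : Measure E).IsAddHaarMeasure]
    {g : E → ℝ} (hg : ContinuousOn g Ω) (h : ∀ φ : 𝓓(Ω, ℝ), ∫ x, φ x * g x = 0) :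
    ∀ x ∈ Ω, g x = 0 := by
  have hae := Ω.isOpen.ae_eq_zero_of_integral_contDiff_smul_eq_zero (μ := volume)
    (locallyIntegrableOn_of_continuousOn hg) fun φ h1 h2 h3 ↦ h ⟨φ, h1, h2, h3⟩
  exact Measure.eqOn_open_of_ae_eq (μ := volume) (g := fun _ ↦ (0 : ℝ))
    ((ae_restrict_iff' Ω.isOpen.measurableSet).2 hae) Ω.isOpen hg continuousOn_const

theorem integral_lineDerivative [(volume : Measure E).IsAddHaarMeasure] (v : E) (φ : 𝓓(Ω, ℝ)) :
    ∫ x, lineDerivative v φ x = 0 := by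
  have h := integral_mul_fderiv_eq_neg_fderiv_mul_of_integrable (μ := (volume : Measure E))
    (f := fun _ ↦ (1 : ℝ)) (g := φ) (v := v) (by simp)
    (by
      have := (lineDerivative v φ).continuous.integrable_of_hasCompactSupport
        (μ := (volume : Measure E)) (lineDerivative v φ).hasCompactSupport
      simpa only [one_mul, ← lineDerivative_apply] using this)
    (by simpa using φ.continuous.integrable_of_hasCompactSupport φ.hasCompactSupport)
    (fun x _ ↦ differentiableAt_const _)
    (fun x _ ↦ (φ.contDiff.differentiable (by simp)) x)
  simpa only [one_mul, ← lineDerivative_apply, fderiv_fun_const, Pi.zero_apply, zero_apply,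
    zero_mul, integral_zero, neg_zero] using h

/-- As `g` is smooth only on `Ω`, integration by parts is applied to the product `g φ`, which is a
test function and whose derivative integrates to zero. -/
theorem integral_mul_fderiv_of_contDiffOn [(volume : Measure E).IsAddHaarMeasure] {g : E → ℝ}
    (hg : ContDiffOn ℝ ∞ g Ω) (v : E) (φ : 𝓓(Ω, ℝ)) :
    ∫ x, φ x * fderiv ℝ g x v = -∫ x, lineDerivative v φ x * g x := by
  have hg' : ContDiffOn ℝ ∞ (fun x ↦ fderiv ℝ g x v) Ω :=
    (hg.fderiv_of_isOpen Ω.isOpen (by simp)).clm_apply contDiffOn_const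
  have h1 := integrable_mul φ (locallyIntegrableOn_of_continuousOn hg'.continuousOn)
  have h2 := integrable_mul (lineDerivative v φ)
    (locallyIntegrableOn_of_continuousOn hg.continuousOn)
  rw [eq_neg_iff_add_eq_zero, ← integral_add h1 h2,
    ← integral_lineDerivative v (mulOn g hg φ)]
  refine integral_congr_ae (.of_forall fun x ↦ ?_)
  have hφ : HasFDerivAt φ (fderiv ℝ φ x) x :=
    ((φ.contDiff.differentiable (by simp)) x).hasFDerivAt
  simp only [lineDerivative_apply]
  by_cases hx : x ∈ tsupport φ
  · have hgx : HasFDerivAt g (fderiv ℝ g x) x :=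
      ((hg.contDiffAt (Ω.isOpen.mem_nhds (φ.tsupport_subset hx))).differentiableAt
        (by simp)).hasFDerivAt
    have : HasFDerivAt (mulOn g hg φ) _ x := hgx.mul hφ
    rw [this.fderiv]
    simp
    ring
  · have h0 : φ =ᶠ[nhds x] 0 := notMem_tsupport_iff_eventuallyEq.1 hx
    have h0' : mulOn g hg φ =ᶠ[nhds x] fun _ ↦ 0 := by
      filter_upwards [h0] with y hy
      simp [hy]
    rw [h0.fderiv_eq, h0'.fderiv_eq, h0.eq_of_nhds]
    simp

/-- Local representations of a distribution by continuous functions glue. -/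
theorem exists_isGivenBy_of_locally [(volume : Measure E).IsAddHaarMeasure] (u : 𝓓'(Ω, ℝ))
    (U : Ω → Opens E) (hU : ∀ x, U x ≤ Ω) (hxU : ∀ x : Ω, (x : E) ∈ U x) (g : Ω → E → ℝ)
    (hg : ∀ x, ContinuousOn (g x) (U x)) (hu : ∀ x, (restrict (hU x) u).IsGivenBy (g x)) :
    ∃ G : E → ℝ, (∀ x, Set.EqOn G (g x) (U x)) ∧ u.IsGivenBy G := by
  classical
  -- At each point the representative chosen for that very point is used; continuous representatives
  -- of the same distribution agree on overlaps, so the choice is immaterial.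
  set G : E → ℝ := fun y ↦ if hy : y ∈ Ω then g ⟨y, hy⟩ y else 0 with hGdef
  have hG : ∀ x, Set.EqOn G (g x) (U x) := by
    intro x y hy
    have hyΩ : y ∈ Ω := hU x hy
    obtain ⟨y, rfl⟩ : ∃ y' : Ω, (y' : E) = y := ⟨⟨y, hyΩ⟩, rfl⟩
    have hGy : G y = g y y := by simp [hGdef]
    have hc : ContinuousOn (fun z ↦ g y z - g x z) (U y ⊓ U x : Opens E) :=
      ((hg y).mono Set.inter_subset_left).sub ((hg x).mono Set.inter_subset_right)
    rw [hGy]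
    refine sub_eq_zero.1 (eqOn_zero_of_forall_integral_mul_eq_zero hc (fun φ ↦ ?_) y
      ⟨hxU y, hy⟩)
    have h1 := (hu y).restrict (inf_le_left : U y ⊓ U x ≤ U y)
    have h2 := (hu x).restrict (inf_le_right : U y ⊓ U x ≤ U x)
    simp only [mul_sub]
    rw [integral_sub (integrable_mul φ h1.1) (integrable_mul φ h2.1), ← h1.2, ← h2.2, sub_eq_zero]
    simp only [restrict_apply]
    congr 1
    ext z
    simp
  have hGc : ContinuousOn G Ω := fun x hx ↦ (((hg ⟨x, hx⟩).congr (hG ⟨x, hx⟩)).continuousAt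
    ((U ⟨x, hx⟩).isOpen.mem_nhds (hxU ⟨x, hx⟩))).continuousWithinAt
  have hGi := locallyIntegrableOn_of_continuousOn hGc
  refine ⟨G, hG, hGi, fun φ ↦ ?_⟩
  rw [← ofFunction_apply hGi, ← sub_eq_zero]
  change (u - ofFunction Ω G) φ = 0
  refine eq_zero_of_locally_isVanishingOn fun x hx ↦ ?_
  obtain ⟨x, rfl⟩ : ∃ x' : Ω, (x' : E) = x := ⟨⟨x, φ.tsupport_subset hx⟩, rfl⟩
  refine ⟨U x, (U x).isOpen, hxU x, fun ψ hψ ↦ ?_⟩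
  change u ψ - ofFunction Ω G ψ = 0
  rw [ofFunction_apply hGi, sub_eq_zero]
  have h := (hu x).2 (ψ.changeDomain hψ)
  have e : extend (hU x) (ψ.changeDomain hψ) = ψ := by ext z; simp
  rw [restrict_apply, e] at h
  rw [h]
  refine integral_congr_ae (.of_forall fun y ↦ ?_)
  by_cases hy : y ∈ tsupport ψ
  · simp [← hG x (hψ hy)]
  · simp [image_eq_zero_of_notMem_tsupport hy]

theorem isSmooth_of_locally [(volume : Measure E).IsAddHaarMeasure] (u : 𝓓'(Ω, ℝ))
    (h : ∀ x ∈ Ω, ∃ (U : Opens E) (hU : U ≤ Ω), x ∈ U ∧ (restrict hU u).IsSmooth) :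
    u.IsSmooth := by
  choose U hU hxU g hg hug using fun x : Ω ↦ h x x.2
  obtain ⟨G, hG, hu⟩ := exists_isGivenBy_of_locally u U hU hxU g (fun x ↦ (hg x).continuousOn) hug
  refine ⟨G, fun x hx ↦ ?_, hu⟩
  exact (((hg ⟨x, hx⟩).congr (hG ⟨x, hx⟩)).contDiffAt
    ((U ⟨x, hx⟩).isOpen.mem_nhds (hxU ⟨x, hx⟩))).contDiffWithinAt

end Distribution
end Regular

/-! ### Integration along coordinate slices of a cube. -/

section Cube

variable {n : ℕ}

/-- The point obtained from `x` by changing its `i`-th coordinate to `s`. -/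
def replaceCoord (i : Fin n) (x : EuclideanSpace ℝ (Fin n)) (s : ℝ) : EuclideanSpace ℝ (Fin n) :=
  x + (s - x i) • EuclideanSpace.single i 1

theorem replaceCoord_apply (i j : Fin n) (x : EuclideanSpace ℝ (Fin n)) (s : ℝ) :
    replaceCoord i x s j = if j = i then s else x j := by
  by_cases h : j = i
  · subst h; simp [replaceCoord]
  · simp [replaceCoord, h]

theorem replaceCoord_self (i : Fin n) (x : EuclideanSpace ℝ (Fin n)) :
    replaceCoord i x (x i) = x := by
  ext j; by_cases h : j = i <;> simp [replaceCoord_apply, h]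

theorem replaceCoord_add_single (i : Fin n) (x : EuclideanSpace ℝ (Fin n)) (h s : ℝ) :
    replaceCoord i (x + h • EuclideanSpace.single i 1) s = replaceCoord i x s := by
  ext j; by_cases h : j = i <;> simp [replaceCoord_apply, h]

theorem contDiff_replaceCoord (i : Fin n) :
    ContDiff ℝ ∞ fun p : EuclideanSpace ℝ (Fin n) × ℝ ↦ replaceCoord i p.1 p.2 := by
  unfold replaceCoord
  fun_prop

theorem continuous_replaceCoord (i : Fin n) (x : EuclideanSpace ℝ (Fin n)) :
    Continuous (replaceCoord i x) :=
  (contDiff_replaceCoord i).continuous.comp (Continuous.prodMk_right x)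

/-- The integral of `f` over the `i`-th coordinate in `[a, b]`. -/
def sliceIntegral (i : Fin n) (a b : ℝ) (f : EuclideanSpace ℝ (Fin n) → ℝ)
    (x : EuclideanSpace ℝ (Fin n)) : ℝ := ∫ s in a..b, f (replaceCoord i x s)

/-- The primitive of `f` in the direction of the `i`-th coordinate that vanishes where this
coordinate is `a`. -/
def slicePrimitive (i : Fin n) (a : ℝ) (f : EuclideanSpace ℝ (Fin n) → ℝ)
    (x : EuclideanSpace ℝ (Fin n)) : ℝ := ∫ s in a..x i, f (replaceCoord i x s)

variable {f : EuclideanSpace ℝ (Fin n) → ℝ}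

theorem contDiff_sliceIntegral (hf : ContDiff ℝ ∞ f) (i : Fin n) (a b : ℝ) :
    ContDiff ℝ ∞ (sliceIntegral i a b f) :=
  (hf.comp (contDiff_replaceCoord i)).parametric_intervalIntegral a b

theorem contDiff_slicePrimitive (hf : ContDiff ℝ ∞ f) (i : Fin n) (a : ℝ) :
    ContDiff ℝ ∞ (slicePrimitive i a f) := by
  -- The substitution s = a + (x i − a)t makes the limits of integration constant.
  have e : slicePrimitive i a f =
      fun x ↦ (x i - a) * ∫ t in (0 : ℝ)..1, f (replaceCoord i x (a + (x i - a) * t)) := by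
    ext x
    rw [slicePrimitive, intervalIntegral.mul_integral_comp_add_mul
      (f := fun s ↦ f (replaceCoord i x s))]
    simp
  rw [e]
  refine ContDiff.mul (by fun_prop) (ContDiff.parametric_intervalIntegral
    (f := fun p : EuclideanSpace ℝ (Fin n) × ℝ ↦
      f (replaceCoord i p.1 (a + (p.1 i - a) * p.2))) ?_ 0 1)
  have h : ContDiff ℝ ∞ fun p : EuclideanSpace ℝ (Fin n) × ℝ ↦ (p.1, a + (p.1 i - a) * p.2) := by
    fun_prop
  exact hf.comp ((contDiff_replaceCoord i).comp h)

theorem fderiv_slicePrimitive (hf : ContDiff ℝ ∞ f) (i : Fin n) (a : ℝ)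
    (x : EuclideanSpace ℝ (Fin n)) :
    fderiv ℝ (slicePrimitive i a f) x (EuclideanSpace.single i 1) = f x := by
  have hd := ((contDiff_slicePrimitive hf i a).differentiable (by simp)) x
  rw [← hd.lineDeriv_eq_fderiv]
  have hc : Continuous fun s ↦ f (replaceCoord i x s) :=
    hf.continuous.comp (continuous_replaceCoord i x)
  have h := (intervalIntegral.integral_hasDerivAt_right (hc.intervalIntegrable a (x i))
    hc.stronglyMeasurable.stronglyMeasurableAtFilter hc.continuousAt)
  have h2 : HasDerivAt (fun t : ℝ ↦ slicePrimitive i a f (x + t • EuclideanSpace.single i 1))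
      (f x) 0 := by
    -- Moving along the `i`-th axis leaves the slice unchanged and moves only the upper limit.
    have e : (fun t : ℝ ↦ slicePrimitive i a f (x + t • EuclideanSpace.single i 1)) =
        fun t ↦ ∫ s in a..x i + t, f (replaceCoord i x s) := by
      ext t
      simp [slicePrimitive, replaceCoord_add_single]
    rw [e]
    rw [replaceCoord_self] at h
    exact HasDerivAt.comp_const_add (x i) 0 (by simpa using h)
  exact h2.deriv

/-- The open cube with center `c` and half side length `ε`. -/
def openCube (c : EuclideanSpace ℝ (Fin n)) (ε : ℝ) : Opens (EuclideanSpace ℝ (Fin n)) :=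
  ⟨WithLp.ofLp ⁻¹' Metric.ball (WithLp.ofLp c) ε,
    Metric.isOpen_ball.preimage (PiLp.continuous_ofLp 2 _)⟩

theorem convex_openCube (c : EuclideanSpace ℝ (Fin n)) (ε : ℝ) :
    Convex ℝ (openCube c ε : Set (EuclideanSpace ℝ (Fin n))) :=
  (convex_ball (WithLp.ofLp c) ε).linear_preimage (WithLp.linearEquiv 2 ℝ (Fin n → ℝ)).toLinearMap

theorem mem_openCube_self (c : EuclideanSpace ℝ (Fin n)) {ε : ℝ} (hε : 0 < ε) :
    c ∈ openCube c ε := Metric.mem_ball_self hε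

theorem exists_openCube_le {Ω : Opens (EuclideanSpace ℝ (Fin n))} {c : EuclideanSpace ℝ (Fin n)}
    (hc : c ∈ Ω) : ∃ ε > 0, openCube c ε ≤ Ω := by
  have h : WithLp.toLp 2 ⁻¹' (Ω : Set (EuclideanSpace ℝ (Fin n))) ∈ nhds (WithLp.ofLp c) :=
    (Ω.isOpen.preimage (PiLp.continuous_toLp 2 _)).mem_nhds hc
  obtain ⟨ε, hε, h⟩ := Metric.mem_nhds_iff.1 h
  exact ⟨ε, hε, fun x hx ↦ h hx⟩

/-- Smooth functions on `ℝⁿ` that vanish outside the closed cube with center `c` and half side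
length `δ`. -/
structure IsSmoothInCube (c : EuclideanSpace ℝ (Fin n)) (δ : ℝ)
    (f : EuclideanSpace ℝ (Fin n) → ℝ) : Prop where
  contDiff : ContDiff ℝ ∞ f
  eq_zero : ∀ x j, δ < |x j - c j| → f x = 0

namespace IsSmoothInCube

variable {c : EuclideanSpace ℝ (Fin n)} {δ ε : ℝ}

theorem tsupport_subset (hδ : 0 ≤ δ) (hf : IsSmoothInCube c δ f) :
    tsupport f ⊆ WithLp.ofLp ⁻¹' Metric.closedBall (WithLp.ofLp c) δ := by
  refine closure_minimal (fun x hx ↦ ?_)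
    (Metric.isClosed_closedBall.preimage (PiLp.continuous_ofLp 2 _))
  by_contra h
  simp only [Set.mem_preimage, Metric.mem_closedBall, dist_pi_le_iff hδ, Real.dist_eq,
    not_forall, not_le] at h
  obtain ⟨j, hj⟩ := h
  exact hx (hf.eq_zero x j hj)

/-- The test function given by a smooth function supported in a closed cube. -/
def toTestFunction (hδ : 0 ≤ δ) (hδε : δ < ε) (hf : IsSmoothInCube c δ f) :
    𝓓(openCube c ε, ℝ) :=
  ⟨f, hf.contDiff, IsCompact.of_isClosed_subset
    (((PiLp.homeomorph 2 (fun _ : Fin n ↦ ℝ)).isClosedEmbedding).isCompact_preimage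
      (isCompact_closedBall (WithLp.ofLp c) δ)) (isClosed_tsupport f) (hf.tsupport_subset hδ),
    (hf.tsupport_subset hδ).trans (Set.preimage_mono (Metric.closedBall_subset_ball hδε))⟩

/-- Compactness of the support leaves a margin δ < ε. The bound ε / 2 ≤ δ ensures that bumps of
radius ε / 2 fit in the same cube. -/
theorem exists_of_testFunction (hε : 0 < ε) (φ : 𝓓(openCube c ε, ℝ)) :
    ∃ δ, ε / 2 ≤ δ ∧ δ < ε ∧ IsSmoothInCube c δ φ := by
  have : ∃ δ, ε / 2 ≤ δ ∧ δ < ε ∧ ∀ x ∈ tsupport φ, dist (WithLp.ofLp x) (WithLp.ofLp c) ≤ δ := by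
    rcases (tsupport φ).eq_empty_or_nonempty with h | h
    · exact ⟨ε / 2, le_rfl, by linarith, by simp [h]⟩
    · obtain ⟨y, hy, hmax⟩ := φ.hasCompactSupport.isCompact.exists_isMaxOn h
        (((PiLp.continuous_ofLp 2 (fun _ : Fin n ↦ ℝ)).dist
          (continuous_const (y := WithLp.ofLp c))).continuousOn)
      have hy' : dist (WithLp.ofLp y) (WithLp.ofLp c) < ε := φ.tsupport_subset hy
      exact ⟨max (ε / 2) (dist (WithLp.ofLp y) (WithLp.ofLp c)), le_max_left _ _,
        max_lt (by linarith) hy', fun x hx ↦ (hmax hx).trans (le_max_right _ _)⟩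
  obtain ⟨δ, h1, h2, h3⟩ := this
  refine ⟨δ, h1, h2, φ.contDiff, fun x j hj ↦ image_eq_zero_of_notMem_tsupport fun hx ↦ ?_⟩
  exact (((dist_le_pi_dist _ _ j).trans (h3 x hx))).not_gt (by simpa [Real.dist_eq] using hj)

variable {ψ : ℝ → ℝ}

/-- The slice integral does not depend on the `i`-th coordinate; the factor `ψ` restores bounded
support in that direction. -/
theorem mul_sliceIntegral (hf : IsSmoothInCube c δ f) {i : Fin n} (hψ : ContDiff ℝ ∞ ψ)
    (hψ0 : ∀ s, δ < |s - c i| → ψ s = 0) (a b : ℝ) :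
    IsSmoothInCube c δ fun x ↦ ψ (x i) * sliceIntegral i a b f x := by
  refine ⟨(hψ.comp (by fun_prop)).mul (contDiff_sliceIntegral hf.contDiff i a b),
    fun x j hj ↦ ?_⟩
  by_cases hji : j = i
  · subst hji; simp [hψ0 _ hj]
  · have : ∀ s, f (replaceCoord i x s) = 0 := fun s ↦
      hf.eq_zero _ j (by simpa [replaceCoord_apply, hji] using hj)
    simp [sliceIntegral, this]

/-- A function supported in a cube is, up to the derivative of another one in the direction of the
`i`-th coordinate, a product of a fixed function of this coordinate and a function of the others. -/
theorem slicePrimitive_sub (hδ : δ < ε) (hf : IsSmoothInCube c δ f) {i : Fin n}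
    (hψ : ContDiff ℝ ∞ ψ) (hψ0 : ∀ s, δ < |s - c i| → ψ s = 0)
    (hψ1 : ∫ s in c i - ε..c i + ε, ψ s = 1) :
    IsSmoothInCube c δ (slicePrimitive i (c i - ε) fun x ↦
      f x - ψ (x i) * sliceIntegral i (c i - ε) (c i + ε) f x) := by
  have hm := hf.mul_sliceIntegral hψ hψ0 (c i - ε) (c i + ε)
  have hk : ContDiff ℝ ∞ fun x ↦ f x - ψ (x i) * sliceIntegral i (c i - ε) (c i + ε) f x :=
    hf.contDiff.sub hm.contDiff
  refine ⟨contDiff_slicePrimitive hk i _, fun x j hj ↦ ?_⟩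
  have hz : ∀ y j, δ < |y j - c j| →
      f y - ψ (y i) * sliceIntegral i (c i - ε) (c i + ε) f y = 0 := fun y j h ↦ by
    rw [hf.eq_zero y j h, hm.eq_zero y j h, sub_zero]
  by_cases hji : j = i
  · subst hji
    have hout : ∀ s, δ < |s - c j| → f (replaceCoord j x s) - ψ (replaceCoord j x s j) *
        sliceIntegral j (c j - ε) (c j + ε) f (replaceCoord j x s) = 0 := fun s hs ↦
      hz _ j (by simpa [replaceCoord_apply] using hs)
    have hcont : Continuous fun s ↦ f (replaceCoord j x s) - ψ (replaceCoord j x s j) *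
        sliceIntegral j (c j - ε) (c j + ε) f (replaceCoord j x s) :=
      hk.continuous.comp (continuous_replaceCoord j x)
    rcases lt_abs.1 hj with h | h
    -- Past the upper face the primitive is the integral over the whole slice, which is zero because
    -- `ψ` has integral 1.
    · rw [slicePrimitive, ← intervalIntegral.integral_add_adjacent_intervals
        (hcont.intervalIntegrable (c j - ε) (c j + ε)) (hcont.intervalIntegrable _ (x j))]
      have h2 : ∫ s in c j + ε..x j, f (replaceCoord j x s) - ψ (replaceCoord j x s j) *
        sliceIntegral j (c j - ε) (c j + ε) f (replaceCoord j x s) = 0 := by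
        refine intervalIntegral.integral_zero_ae (.of_forall fun s hs ↦ hout s ?_)
        refine lt_abs.2 (.inl ?_)
        rcases Set.mem_uIoc.1 hs with h' | h' <;> linarith
      have h3 : ∀ s, sliceIntegral j (c j - ε) (c j + ε) f (replaceCoord j x s) =
          sliceIntegral j (c j - ε) (c j + ε) f x := by
        intro s
        simp only [sliceIntegral]
        congr 1
        ext t
        exact congrArg f (replaceCoord_add_single j x _ t)
      have h4 : Continuous fun s ↦ f (replaceCoord j x s) :=
        hf.contDiff.continuous.comp (continuous_replaceCoord j x)
      rw [h2, add_zero]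
      simp only [h3, replaceCoord_apply, if_true]
      have h5 : Continuous fun s ↦ ψ s * sliceIntegral j (c j - ε) (c j + ε) f x :=
        hψ.continuous.mul continuous_const
      rw [intervalIntegral.integral_sub (h4.intervalIntegrable _ _) (h5.intervalIntegrable _ _),
        intervalIntegral.integral_mul_const, hψ1, one_mul, sliceIntegral, sub_self]
    · rw [slicePrimitive]
      refine intervalIntegral.integral_zero_ae (.of_forall fun s hs ↦ hout s ?_)
      refine lt_abs.2 (.inr ?_)
      rcases Set.mem_uIoc.1 hs with h' | h' <;> linarith
  · have : ∀ s, f (replaceCoord i x s) - ψ (replaceCoord i x s i) *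
        sliceIntegral i (c i - ε) (c i + ε) f (replaceCoord i x s) = 0 := fun s ↦
      hz _ j (by simpa [replaceCoord_apply, hji] using hj)
    simp [slicePrimitive, this]

end IsSmoothInCube

end Cube

open Distribution TestFunction

/-! ### Distributions on a square with zero or smooth gradient. -/

section Gradient

theorem exists_contDiff_integral_eq_one (c : ℝ) {ε : ℝ} (hε : 0 < ε) :
    ∃ ψ : ℝ → ℝ, ContDiff ℝ ∞ ψ ∧ (∀ s, 0 ≤ ψ s) ∧ 0 < ψ c ∧ (∀ s, ε / 2 < |s - c| → ψ s = 0) ∧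
      ∫ s in c - ε..c + ε, ψ s = 1 := by
  let b : ContDiffBump c := ⟨ε / 4, ε / 2, by linarith, by linarith⟩
  have hs : Function.support (b.normed volume) = Metric.ball c (ε / 2) := b.support_normed_eq
  refine ⟨b.normed volume, b.contDiff_normed, fun s ↦ b.nonneg_normed s, ?_, fun s h ↦ ?_, ?_⟩
  · have : c ∈ Function.support (b.normed volume) := by
      rw [hs]; exact Metric.mem_ball_self (by linarith)
    exact lt_of_le_of_ne (b.nonneg_normed c) (Ne.symm this)
  · by_contra h'
    have : s ∈ Metric.ball c (ε / 2) := hs ▸ h'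
    rw [Metric.mem_ball, Real.dist_eq] at this
    linarith
  · rw [intervalIntegral.integral_eq_integral_of_support_subset, b.integral_normed]
    intro s h
    rw [hs, Metric.mem_ball, Real.dist_eq, abs_lt] at h
    exact ⟨by linarith [h.1], by linarith [h.2]⟩

variable {c : EuclideanSpace ℝ (Fin 2)} {ε : ℝ}

/-- The compactly supported Poincaré lemma in top degree, one coordinate at a time: modulo ∂₀ the
function φ becomes ψ₀(x₀) ∫ φ dx₀, and modulo ∂₁ this becomes M ψ₀(x₀) ψ₁(x₁), where M is the
iterated integral of φ. -/
theorem exists_testFunction_decomposition (c : EuclideanSpace ℝ (Fin 2)) (hε : 0 < ε) :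
    ∃ Ψ : 𝓓(openCube c ε, ℝ), ∫ x, Ψ x ≠ 0 ∧ ∀ φ : 𝓓(openCube c ε, ℝ),
      ∃ (M : ℝ) (Φ : Fin 2 → 𝓓(openCube c ε, ℝ)),
        φ = M • Ψ + ∑ j, lineDerivative (EuclideanSpace.single j 1) (Φ j) := by
  choose ψ hψ hψn hψp hψ0 hψ1 using fun i ↦ exists_contDiff_integral_eq_one (c i) hε
  have hΨ : IsSmoothInCube c (ε / 2) fun x ↦ ψ 0 (x 0) * ψ 1 (x 1) := by
    refine ⟨((hψ 0).comp (by fun_prop)).mul ((hψ 1).comp (by fun_prop)), fun x j hj ↦ ?_⟩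
    have h0 := hψ0 j _ hj
    fin_cases j
    · exact mul_eq_zero_of_left h0 _
    · exact mul_eq_zero_of_right _ h0
  refine ⟨hΨ.toTestFunction (by linarith) (by linarith), ?_, fun φ ↦ ?_⟩
  · set Ψ : 𝓓(openCube c ε, ℝ) := hΨ.toTestFunction (by linarith) (by linarith)
    refine (Continuous.integral_pos_of_hasCompactSupport_nonneg_nonzero (x := c) Ψ.continuous
      Ψ.hasCompactSupport (fun x ↦ mul_nonneg (hψn 0 _) (hψn 1 _)) ?_).ne'
    exact (mul_pos (hψp 0) (hψp 1)).ne'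
  · obtain ⟨δ, h1, h2, hφ⟩ := IsSmoothInCube.exists_of_testFunction hε φ
    have hψδ : ∀ i s, δ < |s - c i| → ψ i s = 0 := fun i s hs ↦ hψ0 i s (h1.trans_lt hs)
    have hg := hφ.mul_sliceIntegral (hψ 0) (hψδ 0) (c 0 - ε) (c 0 + ε)
    have hg' := hg.mul_sliceIntegral (hψ 1) (hψδ 1) (c 1 - ε) (c 1 + ε)
    have hP := hφ.slicePrimitive_sub h2 (hψ 0) (hψδ 0) (hψ1 0)
    have hP' := hg.slicePrimitive_sub h2 (hψ 1) (hψδ 1) (hψ1 1)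
    -- The base point 0 is arbitrary: both of its coordinates get replaced by integration variables.
    refine ⟨∫ s in c 1 - ε..c 1 + ε, sliceIntegral 0 (c 0 - ε) (c 0 + ε) φ (replaceCoord 1 0 s),
      ![hP.toTestFunction (by linarith) h2, hP'.toTestFunction (by linarith) h2], ?_⟩
    ext x
    have e1 : ∀ s, (replaceCoord 1 x s) 0 = x 0 := fun s ↦ by simp [replaceCoord_apply]
    have e2 : ∀ s, sliceIntegral 0 (c 0 - ε) (c 0 + ε) φ (replaceCoord 1 x s) =
        sliceIntegral 0 (c 0 - ε) (c 0 + ε) φ (replaceCoord 1 0 s) := by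
      intro s
      simp only [sliceIntegral]
      congr 1
      ext t
      congr 1
      ext j
      fin_cases j <;> simp [replaceCoord_apply]
    have d1 : fderiv ℝ (hP.toTestFunction (by linarith) h2) x (EuclideanSpace.single 0 1) = _ :=
      fderiv_slicePrimitive (hφ.contDiff.sub hg.contDiff) 0 _ x
    have d2 : fderiv ℝ (hP'.toTestFunction (by linarith) h2) x (EuclideanSpace.single 1 1) = _ :=
      fderiv_slicePrimitive (hg.contDiff.sub hg'.contDiff) 1 _ x
    have e3 : sliceIntegral 1 (c 1 - ε) (c 1 + ε)
        (fun x ↦ ψ 0 (x 0) * sliceIntegral 0 (c 0 - ε) (c 0 + ε) φ x) x = ψ 0 (x 0) *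
        ∫ s in c 1 - ε..c 1 + ε, sliceIntegral 0 (c 0 - ε) (c 0 + ε) φ (replaceCoord 1 0 s) := by
      simp only [sliceIntegral.eq_1 1, e1, e2, intervalIntegral.integral_const_mul]
    have e4 : hΨ.toTestFunction (ε := ε) (by linarith) (by linarith) x = ψ 0 (x 0) * ψ 1 (x 1) :=
      rfl
    simp only [Fin.sum_univ_two, add_apply, smul_apply, lineDerivative_apply, Matrix.cons_val_zero,
      Matrix.cons_val_one, d1, d2, e3, e4, smul_eq_mul]
    ring

/-- A distribution with vanishing gradient on a square is constant. -/
theorem exists_const_of_lineDerivative_eq_zero (hε : 0 < ε) (v : 𝓓(openCube c ε, ℝ) →ₗ[ℝ] ℝ)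
    (hv : ∀ j Φ, v (lineDerivative (EuclideanSpace.single j 1) Φ) = 0) :
    ∃ C : ℝ, ∀ φ, v φ = ∫ x, φ x * C := by
  obtain ⟨Ψ, hΨ, h⟩ := exists_testFunction_decomposition c hε
  -- Both `v` and the integral kill the derivative terms of the decomposition, so they are
  -- proportional with the ratio read off at `Ψ`.
  refine ⟨v Ψ / ∫ x, Ψ x, fun φ ↦ ?_⟩
  obtain ⟨M, Φ, rfl⟩ := h φ
  have hi : ∀ φ : 𝓓(openCube c ε, ℝ), Integrable φ :=
    fun φ ↦ φ.continuous.integrable_of_hasCompactSupport φ.hasCompactSupport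
  have e : ∫ x, (M • Ψ + ∑ j, lineDerivative (EuclideanSpace.single j 1) (Φ j) :
      𝓓(openCube c ε, ℝ)) x = M * ∫ x, Ψ x := by
    simp only [Fin.sum_univ_two, add_apply, smul_apply, smul_eq_mul]
    rw [integral_add ((hi Ψ).const_mul M) (g := fun x ↦
      lineDerivative (EuclideanSpace.single 0 1) (Φ 0) x +
        lineDerivative (EuclideanSpace.single 1 1) (Φ 1) x) ((hi _).add (hi _)),
      integral_add (hi _) (hi _),
      integral_lineDerivative, integral_lineDerivative, integral_const_mul]
    ring
  rw [integral_mul_const, e]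
  simp only [map_add, map_smul, map_sum, hv, Finset.sum_const_zero, add_zero, smul_eq_mul]
  field_simp

theorem lineDerivative_comm {Ω : Opens (EuclideanSpace ℝ (Fin 2))} (v w : EuclideanSpace ℝ (Fin 2))
    (φ : 𝓓(Ω, ℝ)) :
    lineDerivative v (lineDerivative w φ) = lineDerivative w (lineDerivative v φ) := by
  have key : ∀ v w x, lineDerivative v (lineDerivative w φ) x = fderiv ℝ (fderiv ℝ φ) x v w := by
    intro v w x
    have hd : DifferentiableAt ℝ (fderiv ℝ φ) x :=
      ((φ.contDiff.fderiv_right (m := ∞) (by simp)).differentiable (by simp)) x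
    have e : ⇑(lineDerivative w φ) = fun y ↦ fderiv ℝ φ y w :=
      funext fun y ↦ lineDerivative_apply w φ y
    rw [lineDerivative_apply, e, fderiv_clm_apply hd (differentiableAt_const w)]
    simp
  ext x
  rw [key, key]
  exact (φ.contDiff.contDiffAt.isSymmSndFDerivAt (by
    simpa using WithTop.coe_le_coe.2 (le_top : (2 : ℕ∞) ≤ ⊤))) v w

theorem apply_self_eq (A : EuclideanSpace ℝ (Fin 2) →L[ℝ] ℝ) (x : EuclideanSpace ℝ (Fin 2)) :
    A x = x 0 * A (EuclideanSpace.single 0 1) + x 1 * A (EuclideanSpace.single 1 1) := by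
  have hx : x = x 0 • EuclideanSpace.single 0 1 + x 1 • EuclideanSpace.single 1 1 := by
    ext j; fin_cases j <;> simp
  conv_lhs => rw [hx]
  simp

/-- A distribution on a square whose gradient is smooth is smooth. -/
theorem exists_smooth_of_lineDerivative_eq (hε : 0 < ε) (v : 𝓓(openCube c ε, ℝ) →ₗ[ℝ] ℝ)
    (G : Fin 2 → EuclideanSpace ℝ (Fin 2) → ℝ) (hG : ∀ j, ContDiffOn ℝ ∞ (G j) (openCube c ε))
    (hv : ∀ j Φ, v (lineDerivative (EuclideanSpace.single j 1) Φ) = -∫ x, Φ x * G j x) :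
    ∃ h, ContDiffOn ℝ ∞ h (openCube c ε) ∧ ∀ φ, v φ = ∫ x, φ x * h x := by
  have hQ := (openCube c ε).isOpen
  have hGd : ∀ j, ∀ x ∈ openCube c ε, DifferentiableAt ℝ (G j) x := fun j x hx ↦
    ((hG j).contDiffAt (hQ.mem_nhds hx)).differentiableAt (by simp)
  have hG' : ∀ i j, ContDiffOn ℝ ∞ (fun x ↦ fderiv ℝ (G i) x (EuclideanSpace.single j 1))
      (openCube c ε) := fun i j ↦
    ((hG i).fderiv_of_isOpen hQ (by simp)).clm_apply contDiffOn_const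
  -- The 1-form with coefficients `G` is closed because `v` takes the same value on both mixed
  -- second derivatives of a test function.
  have hclosed : ∀ x ∈ openCube c ε, fderiv ℝ (G 0) x (EuclideanSpace.single 1 1) -
      fderiv ℝ (G 1) x (EuclideanSpace.single 0 1) = 0 := by
    refine eqOn_zero_of_forall_integral_mul_eq_zero
      ((hG' 0 1).continuousOn.sub (hG' 1 0).continuousOn) fun φ ↦ ?_
    simp only [mul_sub]
    rw [integral_sub (integrable_mul φ (locallyIntegrableOn_of_continuousOn (hG' 0 1).continuousOn))
      (integrable_mul φ (locallyIntegrableOn_of_continuousOn (hG' 1 0).continuousOn)),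
      integral_mul_fderiv_of_contDiffOn (hG 0), integral_mul_fderiv_of_contDiffOn (hG 1), ← hv,
      ← hv, lineDerivative_comm, sub_self]
  let P : Fin 2 → EuclideanSpace ℝ (Fin 2) →L[ℝ] ℝ := fun j ↦ EuclideanSpace.proj j
  let α : EuclideanSpace ℝ (Fin 2) → EuclideanSpace ℝ (Fin 2) →L[ℝ] ℝ := fun x ↦
    G 0 x • P 0 + G 1 x • P 1
  have hα : ContDiffOn ℝ ∞ α (openCube c ε) :=
    ((hG 0).smul contDiffOn_const).add ((hG 1).smul contDiffOn_const)
  -- On the convex cube the closed form has a primitive `h`; `v` minus `h` then has zero gradient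
  -- and is a constant.
  obtain ⟨h, hh⟩ := (convex_openCube c ε).exists_forall_hasFDerivAt_of_fderiv_symmetric hQ
    (hα.differentiableOn (by simp)) (fun a ha x y ↦ by
      have hd : HasFDerivAt α ((fderiv ℝ (G 0) a).smulRight (P 0) +
          (fderiv ℝ (G 1) a).smulRight (P 1)) a :=
        ((hGd 0 a ha).hasFDerivAt.smul_const (P 0)).add ((hGd 1 a ha).hasFDerivAt.smul_const (P 1))
      have hP : ∀ j (z : EuclideanSpace ℝ (Fin 2)), P j z = z j := fun _ _ ↦ rfl
      have hc := hclosed a ha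
      rw [hd.fderiv]
      simp only [add_apply, ContinuousLinearMap.smulRight_apply,
        smul_apply, smul_eq_mul, hP]
      rw [apply_self_eq _ x, apply_self_eq _ x, apply_self_eq _ y, apply_self_eq _ y]
      linear_combination (x 1 * y 0 - y 1 * x 0) * hc)
  have hsm : ContDiffOn ℝ ∞ h (openCube c ε) := by
    rw [contDiffOn_infty_iff_fderiv_of_isOpen hQ]
    exact ⟨fun x hx ↦ (hh x hx).differentiableAt.differentiableWithinAt,
      hα.congr fun x hx ↦ (hh x hx).fderiv⟩
  have hhi := locallyIntegrableOn_of_continuousOn hsm.continuousOn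
  obtain ⟨C, hC⟩ := exists_const_of_lineDerivative_eq_zero hε
    (v - (ofFunction (openCube c ε) h : 𝓓(openCube c ε, ℝ) →L[ℝ] ℝ).toLinearMap) (fun j Φ ↦ by
      have e1 : ofFunction (openCube c ε) h (lineDerivative (EuclideanSpace.single j 1) Φ) = _ :=
        ofFunction_apply hhi _
      have e2 := integral_mul_fderiv_of_contDiffOn hsm (EuclideanSpace.single j 1) Φ
      have e3 : ∫ x, Φ x * fderiv ℝ h x (EuclideanSpace.single j 1) = ∫ x, Φ x * G j x := by
        refine integral_congr_ae (.of_forall fun x ↦ ?_)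
        by_cases hx : x ∈ openCube c ε
        · simp only [(hh x hx).fderiv]
          fin_cases j <;> simp [α, P]
        · simp [Φ.apply_eq_zero_of_notMem hx]
      change v _ - ofFunction (openCube c ε) h (lineDerivative (EuclideanSpace.single j 1) Φ) = 0
      rw [hv, e1, ← e3, e2]
      ring)
  refine ⟨fun x ↦ h x + C, hsm.add contDiffOn_const, fun φ ↦ ?_⟩
  have h1 : v φ - ofFunction (openCube c ε) h φ = _ := hC φ
  rw [ofFunction_apply hhi, sub_eq_iff_eq_add] at h1
  simp only [mul_add]
  rw [h1, integral_add (integrable_mul φ hhi) (integrable_mul φ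
    (locallyIntegrableOn_of_continuousOn continuousOn_const)), add_comm]

end Gradient

open Distribution TestFunction

theorem FirstOrderOperator.onDistributions_apply {n q : ℕ} (L : FirstOrderOperator n q)
    {Ω : Opens (EuclideanSpace ℝ (Fin n))} (u : 𝓓'(Ω, ℝ)) (i : Fin q) (φ : 𝓓(Ω, ℝ)) :
    L.onDistributions u i φ = u (L.formalDual i φ) := rfl

theorem FirstOrderOperator.onDistributions_restrict {n q : ℕ} (L : FirstOrderOperator n q)
    {Ω₁ Ω₂ : Opens (EuclideanSpace ℝ (Fin n))} (h : Ω₁ ≤ Ω₂) (u : 𝓓'(Ω₂, ℝ)) (i : Fin q) :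
    L.onDistributions (restrict h u) i = restrict h (L.onDistributions u i) := by
  ext φ
  change u (extend h (L.formalDual i φ)) = u (L.formalDual i (extend h φ))
  congr 1
  have e : ⇑(extend h φ) = φ := funext fun x ↦ extend_apply h φ x
  ext x
  rw [extend_apply, L.formalDual_apply, L.formalDual_apply, e]

/-! ### The operator L: division by r², the punctured disk, and the origin. -/

section PolarOperator

variable {Ω : Opens (EuclideanSpace ℝ (Fin 2))}

theorem norm_sq_eq_add (x : EuclideanSpace ℝ (Fin 2)) : ‖x‖ ^ 2 = x 0 ^ 2 + x 1 ^ 2 := by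
  simp [EuclideanSpace.real_norm_sq_eq]

theorem hasFDerivAt_coord (j : Fin 2) (x : EuclideanSpace ℝ (Fin 2)) :
    HasFDerivAt (fun y : EuclideanSpace ℝ (Fin 2) ↦ y j)
      (EuclideanSpace.proj j : EuclideanSpace ℝ (Fin 2) →L[ℝ] ℝ) x :=
  (EuclideanSpace.proj j : EuclideanSpace ℝ (Fin 2) →L[ℝ] ℝ).hasFDerivAt

theorem TestFunction.hasFDerivAt (φ : 𝓓(Ω, ℝ)) (x : EuclideanSpace ℝ (Fin 2)) :
    HasFDerivAt φ (fderiv ℝ φ x) x :=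
  ((φ.contDiff.differentiable (by simp)) x).hasFDerivAt

theorem hasFDerivAt_coord_mul (j : Fin 2) (φ : 𝓓(Ω, ℝ)) (x : EuclideanSpace ℝ (Fin 2)) :
    HasFDerivAt (fun y ↦ y j * φ y) (x j • fderiv ℝ φ x +
      φ x • (EuclideanSpace.proj j : EuclideanSpace ℝ (Fin 2) →L[ℝ] ℝ)) x :=
  (hasFDerivAt_coord j x).mul (φ.hasFDerivAt x)

/-- The 4 is the divergence 2 of the Euler field plus the 2 in L₁. -/
theorem polarOperator_formalDual_zero (φ : 𝓓(Ω, ℝ)) (x : EuclideanSpace ℝ (Fin 2)) :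
    polarOperator.formalDual 0 φ x = -(x 0 * fderiv ℝ φ x (EuclideanSpace.single 0 1) +
      x 1 * fderiv ℝ φ x (EuclideanSpace.single 1 1)) - 4 * φ x := by
  rw [FirstOrderOperator.formalDual_apply, Fin.sum_univ_two]
  change -(fderiv ℝ (fun y ↦ y 0 * φ y) x _ + fderiv ℝ (fun y ↦ y 1 * φ y) x _) + -2 * φ x = _
  rw [(hasFDerivAt_coord_mul 0 φ x).fderiv, (hasFDerivAt_coord_mul 1 φ x).fderiv]
  simp
  ring

theorem polarOperator_formalDual_one (φ : 𝓓(Ω, ℝ)) (x : EuclideanSpace ℝ (Fin 2)) :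
    polarOperator.formalDual 1 φ x = x 1 * fderiv ℝ φ x (EuclideanSpace.single 0 1) -
      x 0 * fderiv ℝ φ x (EuclideanSpace.single 1 1) := by
  rw [FirstOrderOperator.formalDual_apply, Fin.sum_univ_two]
  change -(fderiv ℝ (fun y ↦ -y 1 * φ y) x _ + fderiv ℝ (fun y ↦ y 0 * φ y) x _) + 0 * φ x = _
  simp only [neg_mul]
  rw [(hasFDerivAt_coord_mul 1 φ x).fun_neg.fderiv, (hasFDerivAt_coord_mul 0 φ x).fderiv]
  simp
  ring

theorem contDiffOn_div_normSq_pow (h0 : 0 ∉ Ω) {a : EuclideanSpace ℝ (Fin 2) → ℝ}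
    (ha : ContDiffOn ℝ ∞ a Ω) (k : ℕ) : ContDiffOn ℝ ∞ (fun x ↦ a x / (‖x‖ ^ 2) ^ k) Ω := by
  refine ha.div ((contDiff_norm_sq ℝ).contDiffOn.pow k) fun x hx ↦ ?_
  have : x ≠ 0 := fun h ↦ h0 (h ▸ hx)
  positivity

theorem contDiff_coord (j : Fin 2) : ContDiff ℝ ∞ fun x : EuclideanSpace ℝ (Fin 2) ↦ x j := by
  fun_prop

/-- The distribution `u / r²` on an open set without the origin. -/
def divNormSq (h0 : 0 ∉ Ω) (u : 𝓓'(Ω, ℝ)) : 𝓓(Ω, ℝ) →ₗ[ℝ] ℝ :=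
  (u : 𝓓(Ω, ℝ) →L[ℝ] ℝ).toLinearMap ∘ₗ
    mulOn (fun x ↦ 1 / (‖x‖ ^ 2) ^ 1) (contDiffOn_div_normSq_pow h0 contDiffOn_const 1)

theorem fderiv_mul_normSq_sq (Ψ : 𝓓(Ω, ℝ)) (j : Fin 2) (x : EuclideanSpace ℝ (Fin 2)) :
    fderiv ℝ (fun y ↦ (‖y‖ ^ 2) ^ 2 * Ψ y) x (EuclideanSpace.single j 1) =
      (‖x‖ ^ 2) ^ 2 * fderiv ℝ Ψ x (EuclideanSpace.single j 1) + 4 * ‖x‖ ^ 2 * x j * Ψ x := by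
  have h1 := ((hasFDerivAt_id x).norm_sq.pow 2).mul (Ψ.hasFDerivAt x)
  have h2 : HasFDerivAt (fun y ↦ (‖y‖ ^ 2) ^ 2 * Ψ y) _ x := h1
  rw [h2.fderiv]
  simp [EuclideanSpace.inner_single_right]
  ring

/-- Writing Φ = r⁴Ψ turns the quotients by r⁴ below into polynomial multiples of Ψ, so no quotient
has to be differentiated. -/
theorem eq_normSq_sq_mul (h0 : 0 ∉ Ω) (Φ : 𝓓(Ω, ℝ)) :
    ⇑Φ = fun y ↦ (‖y‖ ^ 2) ^ 2 * mulOn (fun x ↦ 1 / (‖x‖ ^ 2) ^ 2)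
      (contDiffOn_div_normSq_pow h0 contDiffOn_const 2) Φ y := by
  ext y
  by_cases hy : y = 0
  · subst hy
    simp [Φ.apply_eq_zero_of_notMem h0]
  · have : ‖y‖ ≠ 0 := norm_ne_zero_iff.2 hy
    simp only [mulOn_apply]
    field_simp

/-- Dual form of ∂v/∂x = (x L₁u − y L₂u)/r⁴ for v = u/r², from ∂/∂x = (x · r∂/∂r − y ∂/∂θ)/r². The
signs flip because the derivative falls on the test function. -/
theorem divNormSq_lineDerivative_zero (h0 : 0 ∉ Ω) (u : 𝓓'(Ω, ℝ)) (Φ : 𝓓(Ω, ℝ)) :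
    divNormSq h0 u (lineDerivative (EuclideanSpace.single 0 1) Φ) =
      polarOperator.onDistributions u 0 (mulOn (fun x ↦ -x 0 / (‖x‖ ^ 2) ^ 2)
        (contDiffOn_div_normSq_pow h0 (contDiff_coord 0).neg.contDiffOn 2) Φ) +
      polarOperator.onDistributions u 1 (mulOn (fun x ↦ x 1 / (‖x‖ ^ 2) ^ 2)
        (contDiffOn_div_normSq_pow h0 (contDiff_coord 1).contDiffOn 2) Φ) := by
  set Ψ := mulOn (fun x ↦ 1 / (‖x‖ ^ 2) ^ 2)
    (contDiffOn_div_normSq_pow h0 contDiffOn_const 2) Φ with hΨ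
  change u _ = _
  rw [FirstOrderOperator.onDistributions_apply, FirstOrderOperator.onDistributions_apply,
    ← map_add]
  congr 1
  ext x
  have hA : ⇑(mulOn (fun x ↦ -x 0 / (‖x‖ ^ 2) ^ 2)
      (contDiffOn_div_normSq_pow h0 (contDiff_coord 0).neg.contDiffOn 2) Φ) =
      fun y ↦ -(y 0 * Ψ y) := by
    ext y; simp [hΨ]; ring
  have hB : ⇑(mulOn (fun x ↦ x 1 / (‖x‖ ^ 2) ^ 2)
      (contDiffOn_div_normSq_pow h0 (contDiff_coord 1).contDiffOn 2) Φ) = fun y ↦ y 1 * Ψ y := by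
    ext y; simp [hΨ]; ring
  rw [add_apply, polarOperator_formalDual_zero, polarOperator_formalDual_one, mulOn_apply,
    lineDerivative_apply, eq_normSq_sq_mul h0 Φ, fderiv_mul_normSq_sq, hA, hB,
    (hasFDerivAt_coord_mul 0 Ψ x).fun_neg.fderiv, (hasFDerivAt_coord_mul 1 Ψ x).fderiv, ← hΨ]
  by_cases hx : x = 0
  · subst hx; simp
  · have hx' : ‖x‖ ≠ 0 := norm_ne_zero_iff.2 hx
    simp
    field_simp
    rw [norm_sq_eq_add]
    ring

/-- Dual form of ∂v/∂y = (y L₁u + x L₂u)/r⁴. -/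
theorem divNormSq_lineDerivative_one (h0 : 0 ∉ Ω) (u : 𝓓'(Ω, ℝ)) (Φ : 𝓓(Ω, ℝ)) :
    divNormSq h0 u (lineDerivative (EuclideanSpace.single 1 1) Φ) =
      polarOperator.onDistributions u 0 (mulOn (fun x ↦ -x 1 / (‖x‖ ^ 2) ^ 2)
        (contDiffOn_div_normSq_pow h0 (contDiff_coord 1).neg.contDiffOn 2) Φ) +
      polarOperator.onDistributions u 1 (mulOn (fun x ↦ -x 0 / (‖x‖ ^ 2) ^ 2)
        (contDiffOn_div_normSq_pow h0 (contDiff_coord 0).neg.contDiffOn 2) Φ) := by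
  set Ψ := mulOn (fun x ↦ 1 / (‖x‖ ^ 2) ^ 2)
    (contDiffOn_div_normSq_pow h0 contDiffOn_const 2) Φ with hΨ
  change u _ = _
  rw [FirstOrderOperator.onDistributions_apply, FirstOrderOperator.onDistributions_apply,
    ← map_add]
  congr 1
  ext x
  have hA : ∀ j : Fin 2, ⇑(mulOn (fun x ↦ -x j / (‖x‖ ^ 2) ^ 2)
      (contDiffOn_div_normSq_pow h0 (contDiff_coord j).neg.contDiffOn 2) Φ) =
      fun y ↦ -(y j * Ψ y) := by
    intro j; ext y; simp [hΨ]; ring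
  rw [add_apply, polarOperator_formalDual_zero, polarOperator_formalDual_one, mulOn_apply,
    lineDerivative_apply, eq_normSq_sq_mul h0 Φ, fderiv_mul_normSq_sq, hA, hA,
    (hasFDerivAt_coord_mul 0 Ψ x).fun_neg.fderiv, (hasFDerivAt_coord_mul 1 Ψ x).fun_neg.fderiv,
    ← hΨ]
  by_cases hx : x = 0
  · subst hx; simp
  · have hx' : ‖x‖ ≠ 0 := norm_ne_zero_iff.2 hx
    simp
    field_simp
    rw [norm_sq_eq_add]
    ring

variable {c : EuclideanSpace ℝ (Fin 2)} {ε : ℝ}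

theorem eq_divNormSq_mulOn (h0 : 0 ∉ Ω) (u : 𝓓'(Ω, ℝ)) (φ : 𝓓(Ω, ℝ)) :
    u φ = divNormSq h0 u (mulOn (fun x ↦ ‖x‖ ^ 2) (contDiff_norm_sq ℝ).contDiffOn φ) := by
  change u _ = u _
  congr 1
  ext x
  by_cases hx : x = 0
  · subst hx; simp [φ.apply_eq_zero_of_notMem h0]
  · have hx' : ‖x‖ ≠ 0 := norm_ne_zero_iff.2 hx
    simp only [mulOn_apply]
    field_simp

theorem polarOperator_isSmooth_openCube (hε : 0 < ε) (h0 : 0 ∉ openCube c ε)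
    (u : 𝓓'(openCube c ε, ℝ)) (hu : ∀ i, (polarOperator.onDistributions u i).IsSmooth) :
    u.IsSmooth := by
  choose f hf hfi hfu using hu
  have hdiv : ∀ j i, ContDiffOn ℝ ∞ (fun x : EuclideanSpace ℝ (Fin 2) ↦
      x j / (‖x‖ ^ 2) ^ 2 * f i x) (openCube c ε) := fun j i ↦
    (contDiffOn_div_normSq_pow h0 (contDiff_coord j).contDiffOn 2).mul (hf i)
  have hint : ∀ (Φ : 𝓓(openCube c ε, ℝ)) j i, Integrable fun x ↦
      Φ x * (x j / (‖x‖ ^ 2) ^ 2 * f i x) := fun Φ j i ↦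
    integrable_mul Φ (locallyIntegrableOn_of_continuousOn (hdiv j i).continuousOn)
  obtain ⟨h, hh, hv⟩ := exists_smooth_of_lineDerivative_eq hε (divNormSq h0 u)
    ![fun x ↦ x 0 / (‖x‖ ^ 2) ^ 2 * f 0 x - x 1 / (‖x‖ ^ 2) ^ 2 * f 1 x,
      fun x ↦ x 1 / (‖x‖ ^ 2) ^ 2 * f 0 x + x 0 / (‖x‖ ^ 2) ^ 2 * f 1 x]
    (fun j ↦ by
      fin_cases j
      · exact (hdiv 0 0).sub (hdiv 1 1)
      · exact (hdiv 1 0).add (hdiv 0 1))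
    (fun j Φ ↦ by
      fin_cases j
      · refine (divNormSq_lineDerivative_zero h0 u Φ).trans ?_
        rw [hfu, hfu, ← integral_neg]
        have h1 := (hint Φ 0 0).neg
        have h2 := hint Φ 1 1
        rw [← integral_add (h1.congr (.of_forall fun x ↦ by simp; ring))
          (h2.congr (.of_forall fun x ↦ by simp; ring))]
        congr 1
        ext x
        simp
        ring
      · refine (divNormSq_lineDerivative_one h0 u Φ).trans ?_
        rw [hfu, hfu, ← integral_neg]
        have h1 := (hint Φ 1 0).neg
        have h2 := (hint Φ 0 1).neg
        rw [← integral_add (h1.congr (.of_forall fun x ↦ by simp; ring))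
          (h2.congr (.of_forall fun x ↦ by simp; ring))]
        congr 1
        ext x
        simp
        ring)
  have hg : ContDiffOn ℝ ∞ (fun x ↦ ‖x‖ ^ 2 * h x) (openCube c ε) :=
    (contDiff_norm_sq ℝ).contDiffOn.mul hh
  refine ⟨fun x ↦ ‖x‖ ^ 2 * h x, hg, locallyIntegrableOn_of_continuousOn hg.continuousOn,
    fun φ ↦ ?_⟩
  rw [eq_divNormSq_mulOn h0, hv]
  congr 1
  ext x
  simp
  ring

theorem polarOperator_isGivenBy_openCube (hε : 0 < ε) (h0 : 0 ∉ openCube c ε)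
    (u : 𝓓'(openCube c ε, ℝ)) (hu : polarOperator.onDistributions u = 0) :
    ∃ C : ℝ, u.IsGivenBy fun x ↦ C * ‖x‖ ^ 2 := by
  obtain ⟨C, hC⟩ := exists_const_of_lineDerivative_eq_zero hε (divNormSq h0 u) (fun j Φ ↦ by
    have hz : ∀ i φ, polarOperator.onDistributions u i φ = 0 := fun i φ ↦ by rw [hu]; rfl
    fin_cases j
    · refine (divNormSq_lineDerivative_zero h0 u Φ).trans ?_
      rw [hz, hz, add_zero]
    · refine (divNormSq_lineDerivative_one h0 u Φ).trans ?_
      rw [hz, hz, add_zero])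
  refine ⟨C, locallyIntegrableOn_of_continuousOn (by fun_prop), fun φ ↦ ?_⟩
  rw [eq_divNormSq_mulOn h0, hC]
  congr 1
  ext x
  simp
  ring

theorem polarOperator_isHypoelliptic_puncturedPlane :
    polarOperator.IsHypoelliptic puncturedPlane := by
  intro Ω hΩ u hu
  refine isSmooth_of_locally u fun x hx ↦ ?_
  obtain ⟨ε, hε, hQ⟩ := exists_openCube_le hx
  refine ⟨openCube x ε, hQ, mem_openCube_self x hε,
    polarOperator_isSmooth_openCube hε (fun h ↦ hΩ (hQ h) rfl) _ fun i ↦ ?_⟩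
  rw [FirstOrderOperator.onDistributions_restrict]
  exact (hu i).restrict hQ

theorem isPreconnected_puncturedDisk (R : ℝ) :
    IsPreconnected (puncturedDisk R : Set (EuclideanSpace ℝ (Fin 2))) := by
  have hr : 1 < Module.rank ℝ (EuclideanSpace ℝ (Fin 2)) := by
    rw [← Module.finrank_eq_rank, finrank_euclideanSpace_fin]
    norm_num
  -- Polar coordinates: the punctured disk is the image of (0, R) × S¹, and the circle is connected
  -- since the dimension exceeds 1.
  have h := ((isPreconnected_Ioo (a := (0 : ℝ)) (b := R)).prod
    (isPreconnected_sphere hr 0 1)).image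
      (fun p : ℝ × EuclideanSpace ℝ (Fin 2) ↦ p.1 • p.2) (by fun_prop)
  convert h using 1
  ext x
  constructor
  · rintro ⟨hx, hx0⟩
    have hx0 : 0 < ‖x‖ := norm_pos_iff.2 hx0
    refine ⟨(‖x‖, ‖x‖⁻¹ • x), ⟨⟨hx0, by simpa using hx⟩, ?_⟩, ?_⟩
    · simp [norm_smul, hx0.ne']
    · simp [smul_smul, hx0.ne']
  · rintro ⟨⟨t, y⟩, ⟨⟨ht0, htR⟩, hy⟩, rfl⟩
    have hy : ‖y‖ = 1 := by simpa using hy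
    have e : ‖t • y‖ = t := by rw [norm_smul, hy, mul_one, Real.norm_of_nonneg ht0.le]
    refine ⟨by simpa [e] using htR, fun h0 ↦ ?_⟩
    have h0 : t • y = 0 := h0
    rw [h0, norm_zero] at e
    exact ht0.ne e

theorem polarOperator_isGivenBy_puncturedDisk {R : ℝ} (u : 𝓓'(puncturedDisk R, ℝ))
    (hu : polarOperator.onDistributions u = 0) : ∃ α : ℝ, u.IsGivenBy fun p ↦ α * ‖p‖ ^ 2 := by
  have hloc : ∀ x : puncturedDisk R, ∃ (U : Opens (EuclideanSpace ℝ (Fin 2)))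
      (hU : U ≤ puncturedDisk R), (x : EuclideanSpace ℝ (Fin 2)) ∈ U ∧
      ∃ C : ℝ, (restrict hU u).IsGivenBy fun p ↦ C * ‖p‖ ^ 2 := by
    intro x
    obtain ⟨ε, hε, hQ⟩ := exists_openCube_le x.2
    refine ⟨openCube x ε, hQ, mem_openCube_self _ hε,
      polarOperator_isGivenBy_openCube hε (fun h ↦ (hQ h).2 rfl) _ ?_⟩
    ext i φ
    rw [FirstOrderOperator.onDistributions_restrict, hu]
    rfl
  choose U hU hxU C hC using hloc
  obtain ⟨G, hG, hu'⟩ := exists_isGivenBy_of_locally u U hU hxU (fun x p ↦ C x * ‖p‖ ^ 2)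
    (fun x ↦ by fun_prop) hC
  have hev : ∀ x : puncturedDisk R, (fun y : EuclideanSpace ℝ (Fin 2) ↦ G y / ‖y‖ ^ 2) =ᶠ[nhds (x : EuclideanSpace ℝ (Fin 2))] fun _ ↦ C x := by
    intro x
    filter_upwards [(U x).isOpen.mem_nhds (hxU x)] with y hy
    have : ‖y‖ ≠ 0 := norm_ne_zero_iff.2 (hU x hy).2
    rw [hG x hy]
    field_simp
  -- The local constants agree because G / r² is locally constant on a connected set.
  have hconst : ∀ x ∈ puncturedDisk R, ∀ y ∈ puncturedDisk R, G x / ‖x‖ ^ 2 = G y / ‖y‖ ^ 2 := by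
    intro x hx y hy
    refine (puncturedDisk R).isOpen.is_const_of_fderiv_eq_zero (𝕜 := ℝ)
      (f := fun y ↦ G y / ‖y‖ ^ 2) (isPreconnected_puncturedDisk R) ?_ ?_ hx hy
    · intro z hz
      exact ((differentiableAt_const _).congr_of_eventuallyEq
        (hev ⟨z, hz⟩)).differentiableWithinAt
    · intro z hz
      rw [(hev ⟨z, hz⟩).fderiv_eq]
      simp
  have : ∃ α : ℝ, ∀ x ∈ puncturedDisk R, G x = α * ‖x‖ ^ 2 := by
    rcases (puncturedDisk R : Set (EuclideanSpace ℝ (Fin 2))).eq_empty_or_nonempty with h | ⟨y, hy⟩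
    · exact ⟨0, fun x hx ↦ (h.subset hx).elim⟩
    · refine ⟨G y / ‖y‖ ^ 2, fun x hx ↦ ?_⟩
      have : ‖x‖ ≠ 0 := norm_ne_zero_iff.2 hx.2
      rw [← hconst x hx y hy]
      field_simp
  obtain ⟨α, hα⟩ := this
  refine ⟨α, locallyIntegrableOn_of_continuousOn (by fun_prop), fun φ ↦ ?_⟩
  rw [hu'.2]
  congr 1
  ext x
  by_cases hx : x ∈ puncturedDisk R
  · rw [hα x hx]
  · simp [φ.apply_eq_zero_of_notMem hx]

/-- A smooth solution `w` of `r ∂w/∂r + 4 w = φ`. -/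
theorem exists_radial_solution (φ : EuclideanSpace ℝ (Fin 2) → ℝ) (hφ : ContDiff ℝ ∞ φ) :
    ∃ w : EuclideanSpace ℝ (Fin 2) → ℝ, ContDiff ℝ ∞ w ∧ ∀ x, fderiv ℝ w x x + 4 * w x = φ x := by
  have hf : ContDiff ℝ ∞ fun p : EuclideanSpace ℝ (Fin 2) × ℝ ↦ p.2 ^ 3 * φ (p.2 • p.1) :=
    (contDiff_snd.pow 3).mul (hφ.comp (contDiff_snd.smul contDiff_fst))
  -- Variation of constants along rays: the integrand of r∂w/∂r + 4w is the t-derivative of t⁴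
  -- φ(tx), whose values at 1 and 0 are φ(x) and 0.
  refine ⟨fun x ↦ ∫ t in (0 : ℝ)..1, t ^ 3 * φ (t • x), hf.parametric_intervalIntegral 0 1,
    fun x ↦ ?_⟩
  have hφx : ∀ y, HasFDerivAt φ (fderiv ℝ φ y) y := fun y ↦
    ((hφ.differentiable (by simp)) y).hasFDerivAt
  have h1 := hasFDerivAt_parametric_intervalIntegral (hf.of_le (by simp)) 0 1 x
  have e : ∀ t : ℝ, (fderiv ℝ (fun p : EuclideanSpace ℝ (Fin 2) × ℝ ↦ p.2 ^ 3 * φ (p.2 • p.1))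
      (x, t)).comp (ContinuousLinearMap.inl ℝ (EuclideanSpace ℝ (Fin 2)) ℝ) =
      t ^ 4 • fderiv ℝ φ (t • x) := by
    intro t
    have a1 : HasFDerivAt (fun y : EuclideanSpace ℝ (Fin 2) ↦ t ^ 3 * φ (t • y))
        (t ^ 4 • fderiv ℝ φ (t • x)) x := by
      have h := ((hφx (t • x)).comp x ((hasFDerivAt_id x).const_smul t)).const_mul (t ^ 3)
      refine h.congr_fderiv ?_
      ext y
      simp
      ring
    have a2 : HasFDerivAt (fun y : EuclideanSpace ℝ (Fin 2) ↦ (y, t))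
      (ContinuousLinearMap.inl ℝ (EuclideanSpace ℝ (Fin 2)) ℝ) x := hasFDerivAt_prodMk_left x t
    have a3 := (((hf.differentiable (by simp)) (x, t)).hasFDerivAt).comp x a2
    exact a3.unique a1
  simp only [e] at h1
  rw [h1.fderiv]
  have hc : Continuous fun t : ℝ ↦ t ^ 4 • fderiv ℝ φ (t • x) :=
    (continuous_pow 4).smul ((hφ.continuous_fderiv (by simp)).comp (by fun_prop))
  have hc' : Continuous fun t : ℝ ↦ t ^ 4 * fderiv ℝ φ (t • x) x :=
    hc.clm_apply continuous_const
  have hc2 : Continuous fun t : ℝ ↦ 4 * (t ^ 3 * φ (t • x)) := by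
    have := hφ.continuous
    fun_prop
  rw [ContinuousLinearMap.intervalIntegral_apply (hc.intervalIntegrable 0 1),
    ← intervalIntegral.integral_const_mul]
  simp only [smul_apply, smul_eq_mul]
  rw [← intervalIntegral.integral_add (hc'.intervalIntegrable 0 1) (hc2.intervalIntegrable 0 1),
    intervalIntegral.integral_eq_sub_of_hasDerivAt (f := fun t ↦ t ^ 4 * φ (t • x))
      (f' := fun t ↦ t ^ 4 * fderiv ℝ φ (t • x) x + 4 * (t ^ 3 * φ (t • x))) (fun t _ ↦ ?_)
      ((hc'.add hc2).intervalIntegrable 0 1)]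
  · simp
  · have h := (hasDerivAt_pow 4 t).mul ((hφx (t • x)).comp_hasDerivAt t
      ((hasDerivAt_id t).smul_const x))
    refine h.congr_deriv ?_
    simp
    ring

theorem eq_zero_of_dsupport_subset (u : 𝓓'(Ω, ℝ)) (hs : dsupport u ⊆ {0})
    (hu : polarOperator.onDistributions u 0 = 0) : u = 0 := by
  have hvan : ∀ φ : 𝓓(Ω, ℝ), 0 ∉ tsupport φ → u φ = 0 := by
    intro φ h0
    refine eq_zero_of_locally_isVanishingOn fun x hx ↦ ?_
    have : x ∉ dsupport u := fun h ↦ h0 ((hs h : x = 0) ▸ hx)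
    obtain ⟨s, h1, h2, h3⟩ := (notMem_dsupport_iff x).1 this
    exact ⟨s, h2, h3, h1⟩
  ext φ
  change u φ = 0
  by_cases h0 : 0 ∈ Ω
  · obtain ⟨w, hw, hwφ⟩ := exists_radial_solution φ φ.contDiff
    obtain ⟨r, hr, hball⟩ := Metric.mem_nhds_iff.1 (Ω.isOpen.mem_nhds h0)
    let η : ContDiffBump (0 : EuclideanSpace ℝ (Fin 2)) := ⟨r / 4, r / 2, by linarith, by linarith⟩
    let η' : 𝓓(Ω, ℝ) := ⟨η, η.contDiff, η.hasCompactSupport, by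
      rw [η.tsupport_eq]
      exact (Metric.closedBall_subset_ball (by change r / 2 < r; linarith)).trans hball⟩
    have hψ : ⇑(mulOn w hw.contDiffOn η') =ᶠ[nhds 0] w := by
      filter_upwards [η.eventuallyEq_one] with x hx
      have hx : η' x = 1 := hx
      simp [hx]
    -- Near 0 the cutoff is 1, so L₁* of the product is −(r∂w/∂r + 4w) = −φ and the sum vanishes
    -- there; the added term does not change the value of `u`, as L₁u = 0.
    have h := hvan (φ + polarOperator.formalDual 0 (mulOn w hw.contDiffOn η')) (by
      rw [notMem_tsupport_iff_eventuallyEq]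
      filter_upwards [hψ.eventually_nhds] with x hx
      have hx : ⇑(mulOn w hw.contDiffOn η') =ᶠ[nhds x] w := hx
      rw [add_apply, polarOperator_formalDual_zero, hx.fderiv_eq, hx.eq_of_nhds, ← apply_self_eq,
        ← hwφ]
      simp)
    rw [map_add, ← FirstOrderOperator.onDistributions_apply, hu] at h
    simpa using h
  · exact hvan φ fun h ↦ h0 (φ.tsupport_subset h)

theorem polarOperator_onDistributions_normSq (α : ℝ) :
    polarOperator.onDistributions (ofFunction Ω fun p ↦ α * ‖p‖ ^ 2) 0 = 0 := by
  ext φ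
  have hsm : ContDiff ℝ ∞ fun p : EuclideanSpace ℝ (Fin 2) ↦ α * ‖p‖ ^ 2 :=
    contDiff_const.mul (contDiff_norm_sq ℝ)
  rw [FirstOrderOperator.onDistributions_apply,
    ofFunction_apply (locallyIntegrableOn_of_continuousOn hsm.continuous.continuousOn)]
  have h := polarOperator.integral_onFunctions_mul 0 _ hsm φ
  have e : ∀ x, polarOperator.onFunctions (fun p ↦ α * ‖p‖ ^ 2) 0 x = 0 := by
    intro x
    have hd : HasFDerivAt (fun p : EuclideanSpace ℝ (Fin 2) ↦ α * ‖p‖ ^ 2) _ x :=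
      ((hasFDerivAt_id x).norm_sq).const_mul α
    rw [FirstOrderOperator.onFunctions, Fin.sum_univ_two]
    change x 0 * _ + x 1 * _ + -2 * _ = 0
    rw [← apply_self_eq, hd.fderiv]
    simp
    ring
  simp only [e, zero_mul, integral_zero] at h
  simp only [mul_comm _ (α * _)]
  exact h.symm

theorem polarOperator_isWeaklyHypoelliptic : polarOperator.IsWeaklyHypoelliptic ⊤ := by
  intro Ω _ u hu
  have hres : ∀ (U : Opens (EuclideanSpace ℝ (Fin 2))) (hU : U ≤ Ω),
      polarOperator.onDistributions (restrict hU u) = 0 := by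
    intro U hU
    ext i φ
    rw [FirstOrderOperator.onDistributions_restrict, hu]
    rfl
  refine isSmooth_of_locally u fun x hx ↦ ?_
  by_cases hx0 : x = 0
  · subst hx0
    obtain ⟨R, hR, hball⟩ := Metric.mem_nhds_iff.1 (Ω.isOpen.mem_nhds hx)
    let B : Opens (EuclideanSpace ℝ (Fin 2)) := ⟨Metric.ball 0 R, Metric.isOpen_ball⟩
    have hBΩ : B ≤ Ω := hball
    have hDB : puncturedDisk R ≤ B := Set.sdiff_subset
    obtain ⟨α, hα⟩ := polarOperator_isGivenBy_puncturedDisk _ (hres _ (hDB.trans hBΩ))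
    have hsm : ContDiff ℝ ∞ fun p : EuclideanSpace ℝ (Fin 2) ↦ α * ‖p‖ ^ 2 :=
      contDiff_const.mul (contDiff_norm_sq ℝ)
    have hli : LocallyIntegrableOn (fun p ↦ α * ‖p‖ ^ 2) (B : Set (EuclideanSpace ℝ (Fin 2))) :=
      locallyIntegrableOn_of_continuousOn hsm.continuous.continuousOn
    -- The difference with α r² vanishes off the origin and is annihilated by L₁, hence is zero on
    -- the whole ball.
    have hw : restrict hBΩ u - ofFunction B (fun p ↦ α * ‖p‖ ^ 2) = 0 := by
      refine eq_zero_of_dsupport_subset _ (fun x hx ↦ ?_) ?_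
      · by_contra hx0
        refine (notMem_dsupport_iff x).2 ⟨{0}ᶜ, fun ψ hψ ↦ ?_, isOpen_compl_singleton, hx0⟩ hx
        change restrict hBΩ u ψ - ofFunction B (fun p ↦ α * ‖p‖ ^ 2) ψ = 0
        have h := hα.2 (ψ.changeDomain fun x hx ↦ ⟨ψ.tsupport_subset hx, hψ hx⟩)
        rw [ofFunction_apply hli, sub_eq_zero]
        refine Eq.trans ?_ h
        simp only [restrict_apply]
        congr 1
        ext x
        simp only [extend_apply]
        rfl
      · have h1 := congrFun (hres B hBΩ) 0
        have h2 := polarOperator_onDistributions_normSq (Ω := B) α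
        ext φ
        have h1 : restrict hBΩ u (polarOperator.formalDual 0 φ) = 0 := DFunLike.congr_fun h1 φ
        have h2 : ofFunction B (fun p ↦ α * ‖p‖ ^ 2) (polarOperator.formalDual 0 φ) = 0 :=
          DFunLike.congr_fun h2 φ
        change restrict hBΩ u (polarOperator.formalDual 0 φ) -
          ofFunction B (fun p ↦ α * ‖p‖ ^ 2) (polarOperator.formalDual 0 φ) = 0
        rw [h1, h2, sub_zero]
    refine ⟨B, hBΩ, Metric.mem_ball_self hR, _, hsm.contDiffOn, ?_⟩
    rw [sub_eq_zero.1 hw]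
    exact isGivenBy_ofFunction hli
  · have hx' : x ∈ Ω ⊓ puncturedPlane := ⟨hx, hx0⟩
    obtain ⟨ε, hε, hQ⟩ := exists_openCube_le hx'
    obtain ⟨C, hC⟩ := polarOperator_isGivenBy_openCube hε (fun h ↦ (hQ h).2 rfl) _
      (hres _ (hQ.trans inf_le_left))
    exact ⟨openCube x ε, hQ.trans inf_le_left, mem_openCube_self x hε, _,
      (contDiff_const.mul (contDiff_norm_sq ℝ)).contDiffOn, hC⟩

end PolarOperator

/-! ### The counterexample r² log r. -/

section Logarithm

/-- At 0 the right side is zero, and the claim is r log r → 0. Elsewhere log r = ½ log r² reduces it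
to the smooth function r². -/
theorem hasFDerivAt_normSq_mul_log (x : EuclideanSpace ℝ (Fin 2)) :
    HasFDerivAt (fun p : EuclideanSpace ℝ (Fin 2) ↦ ‖p‖ ^ 2 * Real.log ‖p‖)
      ((2 * Real.log ‖x‖ + 1) • innerSL ℝ x) x := by
  by_cases hx : x = 0
  · subst hx
    rw [hasFDerivAt_iff_isLittleO_nhds_zero]
    have h : Filter.Tendsto (fun p : EuclideanSpace ℝ (Fin 2) ↦ ‖p‖ * Real.log ‖p‖) (nhds 0)
        (nhds 0) := by
      have := (Real.continuous_mul_log.comp continuous_norm).tendsto (0 : EuclideanSpace ℝ (Fin 2))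
      simpa [Function.comp_def] using this
    have h2 := (Asymptotics.isBigO_refl (fun p : EuclideanSpace ℝ (Fin 2) ↦ ‖p‖)
      (nhds 0)).mul_isLittleO ((Asymptotics.isLittleO_one_iff ℝ).2 h)
    rw [← Asymptotics.isLittleO_norm_right]
    refine h2.congr (fun p ↦ ?_) (fun p ↦ by simp)
    simp
    ring
  · have hx' : ‖x‖ ≠ 0 := norm_ne_zero_iff.2 hx
    have h1 : HasFDerivAt (fun p : EuclideanSpace ℝ (Fin 2) ↦ ‖p‖ ^ 2) _ x :=
      (hasFDerivAt_id x).norm_sq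
    have h2 := (h1.mul (h1.log (by positivity))).const_mul (1 / 2 : ℝ)
    have e : (fun p : EuclideanSpace ℝ (Fin 2) ↦ ‖p‖ ^ 2 * Real.log ‖p‖) =
        fun p ↦ 1 / 2 * (‖p‖ ^ 2 * Real.log (‖p‖ ^ 2)) := by
      ext p; rw [Real.log_pow]; push_cast; ring
    rw [e]
    refine h2.congr_fderiv ?_
    ext v
    simp
    field_simp
    ring

theorem continuous_log_mul_coord (j : Fin 2) :
    Continuous fun x : EuclideanSpace ℝ (Fin 2) ↦ (2 * Real.log ‖x‖ + 1) * x j := by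
  have h : Continuous fun x : EuclideanSpace ℝ (Fin 2) ↦ Real.log ‖x‖ * x j := by
    refine continuous_iff_continuousAt.2 fun x ↦ ?_
    by_cases hx : x = 0
    · subst hx
      have h : Filter.Tendsto (fun p : EuclideanSpace ℝ (Fin 2) ↦ |‖p‖ * Real.log ‖p‖|) (nhds 0)
          (nhds 0) := by
        have := ((Real.continuous_mul_log.comp continuous_norm).abs).tendsto
          (0 : EuclideanSpace ℝ (Fin 2))
        simpa [Function.comp_def] using this
      have h0 : Filter.Tendsto (fun p : EuclideanSpace ℝ (Fin 2) ↦ Real.log ‖p‖ * p j) (nhds 0)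
          (nhds 0) := by
        refine squeeze_zero_norm (fun p ↦ ?_) h
        rw [norm_mul, abs_mul, mul_comm, abs_norm, Real.norm_eq_abs (Real.log _)]
        gcongr
        exact PiLp.norm_apply_le p j
      simpa [ContinuousAt] using h0
    · exact (continuous_norm.continuousAt.log (norm_ne_zero_iff.2 hx)).mul (by fun_prop)
  have e : (fun x : EuclideanSpace ℝ (Fin 2) ↦ (2 * Real.log ‖x‖ + 1) * x j) =
      fun x ↦ 2 * (Real.log ‖x‖ * x j) + x j := by
    ext x; ring
  rw [e]
  fun_prop

theorem continuous_normSq_mul_log :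
    Continuous fun p : EuclideanSpace ℝ (Fin 2) ↦ ‖p‖ ^ 2 * Real.log ‖p‖ :=
  continuous_iff_continuousAt.2 fun x ↦ (hasFDerivAt_normSq_mul_log x).continuousAt

theorem fderiv_normSq_mul_log (x : EuclideanSpace ℝ (Fin 2)) (j : Fin 2) :
    fderiv ℝ (fun p : EuclideanSpace ℝ (Fin 2) ↦ ‖p‖ ^ 2 * Real.log ‖p‖) x
      (EuclideanSpace.single j 1) = (2 * Real.log ‖x‖ + 1) * x j := by
  rw [(hasFDerivAt_normSq_mul_log x).fderiv]
  simp [EuclideanSpace.inner_single_right]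

variable {Ω : Opens (EuclideanSpace ℝ (Fin 2))}

/-- Since r² log r is C¹ across the origin, integration by parts produces no contribution from
there. -/
theorem integral_lineDerivative_mul_normSq_mul_log (φ : 𝓓(Ω, ℝ)) (j : Fin 2) :
    ∫ x, lineDerivative (EuclideanSpace.single j 1) φ x * (‖x‖ ^ 2 * Real.log ‖x‖) =
      -∫ x, φ x * ((2 * Real.log ‖x‖ + 1) * x j) := by
  have h := integral_mul_fderiv_eq_neg_fderiv_mul_of_integrable
    (μ := (volume : Measure (EuclideanSpace ℝ (Fin 2))))
    (f := fun p ↦ ‖p‖ ^ 2 * Real.log ‖p‖) (g := φ) (v := EuclideanSpace.single j 1)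
    (by
      simp only [fderiv_normSq_mul_log]
      simpa only [mul_comm] using integrable_mul φ
        (locallyIntegrableOn_of_continuousOn (continuous_log_mul_coord j).continuousOn))
    (by
      simpa only [mul_comm, ← lineDerivative_apply] using
        integrable_mul (lineDerivative (EuclideanSpace.single j 1) φ)
        (locallyIntegrableOn_of_continuousOn continuous_normSq_mul_log.continuousOn))
    (by
      simpa only [mul_comm] using integrable_mul φ
        (locallyIntegrableOn_of_continuousOn continuous_normSq_mul_log.continuousOn))
    (fun x _ ↦ (hasFDerivAt_normSq_mul_log x).differentiableAt)
    (fun x _ ↦ (φ.contDiff.differentiable (by simp)) x)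
  simp only [fderiv_normSq_mul_log, ← lineDerivative_apply] at h
  simp only [mul_comm (lineDerivative _ φ _), mul_comm (φ _)]
  exact h

theorem locallyIntegrableOn_normSq_mul_log :
    LocallyIntegrableOn (fun p : EuclideanSpace ℝ (Fin 2) ↦ ‖p‖ ^ 2 * Real.log ‖p‖) Ω :=
  locallyIntegrableOn_of_continuousOn continuous_normSq_mul_log.continuousOn

theorem polarOperator_normSq_mul_log_zero :
    (polarOperator.onDistributions (ofFunction Ω fun p ↦ ‖p‖ ^ 2 * Real.log ‖p‖) 0).IsGivenBy
      fun p ↦ ‖p‖ ^ 2 := by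
  refine ⟨locallyIntegrableOn_of_continuousOn (by fun_prop), fun φ ↦ ?_⟩
  rw [FirstOrderOperator.onDistributions_apply]
  -- In divergence form the derivatives fall on the test functions x_j φ. Integrating by parts gives
  -- (2 log r + 1)r² − 2r² log r = r² against φ.
  have e : polarOperator.formalDual 0 φ =
      -(lineDerivative (EuclideanSpace.single 0 1)
          (mulOn (fun x ↦ x 0) (contDiff_coord 0).contDiffOn φ) +
        lineDerivative (EuclideanSpace.single 1 1)
          (mulOn (fun x ↦ x 1) (contDiff_coord 1).contDiffOn φ)) - (2 : ℝ) • φ := by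
    ext x
    have h : ∀ j : Fin 2, HasFDerivAt (mulOn (fun x ↦ x j) (contDiff_coord j).contDiffOn φ) _ x :=
      fun j ↦ hasFDerivAt_coord_mul j φ x
    rw [polarOperator_formalDual_zero, sub_apply, neg_apply, add_apply, lineDerivative_apply,
      lineDerivative_apply, (h 0).fderiv, (h 1).fderiv]
    simp
    ring
  have hi : ∀ j, Integrable fun x ↦ mulOn (fun x ↦ x j) (contDiff_coord j).contDiffOn φ x *
      ((2 * Real.log ‖x‖ + 1) * x j) := fun j ↦ integrable_mul _
    (locallyIntegrableOn_of_continuousOn (continuous_log_mul_coord j).continuousOn)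
  rw [e, map_sub, map_neg, map_add, map_smul]
  simp only [ofFunction_apply locallyIntegrableOn_normSq_mul_log]
  rw [integral_lineDerivative_mul_normSq_mul_log, integral_lineDerivative_mul_normSq_mul_log,
    ← neg_add, neg_neg, ← integral_add (hi 0) (hi 1), smul_eq_mul, ← integral_const_mul,
    ← integral_sub (f := fun x ↦ mulOn (fun x ↦ x 0) (contDiff_coord 0).contDiffOn φ x *
        ((2 * Real.log ‖x‖ + 1) * x 0) + mulOn (fun x ↦ x 1) (contDiff_coord 1).contDiffOn φ x *
        ((2 * Real.log ‖x‖ + 1) * x 1)) ((hi 0).add (hi 1))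
      ((integrable_mul φ locallyIntegrableOn_normSq_mul_log).const_mul 2)]
  congr 1
  ext x
  simp only [mulOn_apply, norm_sq_eq_add]
  ring

theorem polarOperator_normSq_mul_log_one :
    polarOperator.onDistributions (ofFunction Ω fun p ↦ ‖p‖ ^ 2 * Real.log ‖p‖) 1 = 0 := by
  ext φ
  rw [FirstOrderOperator.onDistributions_apply]
  have e : polarOperator.formalDual 1 φ =
      lineDerivative (EuclideanSpace.single 0 1)
          (mulOn (fun x ↦ x 1) (contDiff_coord 1).contDiffOn φ) -
        lineDerivative (EuclideanSpace.single 1 1)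
          (mulOn (fun x ↦ x 0) (contDiff_coord 0).contDiffOn φ) := by
    ext x
    have h : ∀ j : Fin 2, HasFDerivAt (mulOn (fun x ↦ x j) (contDiff_coord j).contDiffOn φ) _ x :=
      fun j ↦ hasFDerivAt_coord_mul j φ x
    rw [polarOperator_formalDual_one, sub_apply, lineDerivative_apply,
      lineDerivative_apply, (h 0).fderiv, (h 1).fderiv]
    simp
  rw [e, map_sub]
  simp only [ofFunction_apply locallyIntegrableOn_normSq_mul_log]
  rw [integral_lineDerivative_mul_normSq_mul_log, integral_lineDerivative_mul_normSq_mul_log,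
    sub_neg_eq_add]
  refine neg_add_eq_zero.2 ?_
  congr 1
  ext x
  simp only [mulOn_apply]
  ring

/-- A smooth representative would equal r² log r everywhere by continuity. But on the first axis its
first partial derivative is (2 log t + 1)t for t > 0, with difference quotient at 0 tending to −∞.
-/
theorem not_isSmooth_normSq_mul_log :
    ¬ (ofFunction (⊤ : Opens (EuclideanSpace ℝ (Fin 2)))
      fun p ↦ ‖p‖ ^ 2 * Real.log ‖p‖).IsSmooth := by
  rintro ⟨h, hh, hi, hu⟩
  have heq : ∀ x ∈ (⊤ : Opens (EuclideanSpace ℝ (Fin 2))), ‖x‖ ^ 2 * Real.log ‖x‖ - h x = 0 := by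
    refine eqOn_zero_of_forall_integral_mul_eq_zero
      (continuous_normSq_mul_log.continuousOn.sub hh.continuousOn) fun φ ↦ ?_
    simp only [mul_sub]
    rw [integral_sub (integrable_mul φ locallyIntegrableOn_normSq_mul_log) (integrable_mul φ hi),
      ← hu, ofFunction_apply locallyIntegrableOn_normSq_mul_log, sub_self]
  have e : (fun p : EuclideanSpace ℝ (Fin 2) ↦ ‖p‖ ^ 2 * Real.log ‖p‖) = h :=
    funext fun x ↦ sub_eq_zero.1 (heq x trivial)
  have hsm : ContDiff ℝ ∞ fun p : EuclideanSpace ℝ (Fin 2) ↦ ‖p‖ ^ 2 * Real.log ‖p‖ := by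
    rw [e]; exact contDiffOn_univ.1 hh
  have hd : Differentiable ℝ fun x : EuclideanSpace ℝ (Fin 2) ↦
      (2 * Real.log ‖x‖ + 1) * x 0 := by
    simp only [← fderiv_normSq_mul_log]
    exact ((hsm.fderiv_right (m := ∞) (by simp)).clm_apply contDiff_const).differentiable (by simp)
  have hline : DifferentiableAt ℝ (fun t : ℝ ↦ (2 * Real.log t + 1) * t) 0 := by
    have h1 : DifferentiableAt ℝ (fun t : ℝ ↦
        (t • EuclideanSpace.single 0 1 : EuclideanSpace ℝ (Fin 2))) 0 := by fun_prop
    refine ((hd _).comp (0 : ℝ) h1).congr_of_eventuallyEq (.of_forall fun t ↦ ?_)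
    simp [norm_smul]
  have hslope := (hasDerivAt_iff_tendsto_slope.1 hline.hasDerivAt).mono_left
    (nhdsWithin_mono 0 fun t (ht : 0 < t) ↦ ht.ne')
  have hlog : Filter.Tendsto (fun t : ℝ ↦ 2 * Real.log t + 1) (nhdsWithin 0 (Set.Ioi 0))
      Filter.atBot :=
    Filter.tendsto_atBot_add_const_right _ _
      (Real.tendsto_log_nhdsGT_zero.const_mul_atBot two_pos)
  refine not_tendsto_nhds_of_tendsto_atBot hlog _ (hslope.congr' ?_)
  filter_upwards [self_mem_nhdsWithin] with t ht
  have ht : t ≠ 0 := ne_of_gt ht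
  simp [slope_def_field]
  field_simp

end Logarithm

/-- The symbol sends ξ to the pair (x₀ξ₀ + x₁ξ₁, x₀ξ₁ − x₁ξ₀), a linear map in ξ with determinant
|x|². -/
theorem polarOperator_isOverdeterminedElliptic :
    polarOperator.IsOverdeterminedElliptic puncturedPlane := by
  intro x hx ξ hξ
  have hx : x ≠ 0 := hx
  refine (injective_iff_map_eq_zero _).2 fun t ht ↦ ?_
  have h0 := congrFun ht 0
  have h1 := congrFun ht 1
  simp only [FirstOrderOperator.principalSymbol, polarOperator, LinearMap.toSpanSingleton_apply,
    Fin.sum_univ_two] at h0 h1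
  simp at h0 h1
  by_contra hne
  have h0 := h0.resolve_left hne
  have h1 := h1.resolve_left hne
  have hN : x 0 ^ 2 + x 1 ^ 2 ≠ 0 := by
    rw [← norm_sq_eq_add]; exact pow_ne_zero 2 (norm_ne_zero_iff.2 hx)
  apply hξ
  ext j
  fin_cases j
  · refine (mul_eq_zero.1 (?_ : (x 0 ^ 2 + x 1 ^ 2) * ξ 0 = 0)).resolve_left hN
    linear_combination x 0 * h0 - x 1 * h1
  · refine (mul_eq_zero.1 (?_ : (x 0 ^ 2 + x 1 ^ 2) * ξ 1 = 0)).resolve_left hN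
    linear_combination x 1 * h0 + x 0 * h1

end
theorem mainTheorem7 :
    -- `L` is weakly hypoelliptic, but not hypoelliptic, over `ℝ²`
    polarOperator.IsWeaklyHypoelliptic ⊤ ∧
    ¬ polarOperator.IsHypoelliptic ⊤ ∧
    -- `r² log r` is not smooth, while `L (r² log r) = (r², 0)` is
    (∃ u : 𝓓'((⊤ : Opens (EuclideanSpace ℝ (Fin 2))), ℝ),
      u.IsGivenBy (fun p ↦ ‖p‖ ^ 2 * Real.log ‖p‖) ∧
      (polarOperator.onDistributions u 0).IsGivenBy (fun p ↦ ‖p‖ ^ 2) ∧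
      polarOperator.onDistributions u 1 = 0 ∧
      ¬ u.IsSmooth) ∧
    -- away from the origin, `L` is overdetermined elliptic and hypoelliptic
    polarOperator.IsOverdeterminedElliptic puncturedPlane ∧
    polarOperator.IsHypoelliptic puncturedPlane ∧
    -- away from the origin, solutions on disks are multiples of `r²`
    (∀ R : ℝ, 0 < R → ∀ u : 𝓓'(puncturedDisk R, ℝ), polarOperator.onDistributions u = 0 →
      ∃ α : ℝ, u.IsGivenBy (fun p ↦ α * ‖p‖ ^ 2)) ∧
    -- a distribution supported at the origin and annihilated by `L₁` vanishes
    (∀ (Ω : Opens (EuclideanSpace ℝ (Fin 2))) (u : 𝓓'(Ω, ℝ)),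
      Distribution.dsupport u ⊆ {0} → polarOperator.onDistributions u 0 = 0 → u = 0) := by
  refine ⟨polarOperator_isWeaklyHypoelliptic, fun h ↦ ?_, ⟨_,
    Distribution.isGivenBy_ofFunction locallyIntegrableOn_normSq_mul_log, polarOperator_normSq_mul_log_zero,
    polarOperator_normSq_mul_log_one, not_isSmooth_normSq_mul_log⟩,
    polarOperator_isOverdeterminedElliptic, polarOperator_isHypoelliptic_puncturedPlane,
    fun R _ u hu ↦ polarOperator_isGivenBy_puncturedDisk u hu,
    fun Ω u ↦ eq_zero_of_dsupport_subset u⟩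
  refine not_isSmooth_normSq_mul_log (h ⊤ le_rfl _ fun i ↦ ?_)
  fin_cases i
  · exact ⟨_, (contDiff_norm_sq ℝ).contDiffOn, polarOperator_normSq_mul_log_zero⟩
  · refine ⟨fun _ ↦ 0, contDiffOn_const, Distribution.locallyIntegrableOn_of_continuousOn continuousOn_const,
      fun φ ↦ ?_⟩
    have h := DFunLike.congr_fun (polarOperator_normSq_mul_log_one (Ω := ⊤)) φ
    simpa using h
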